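/- Let $Q=\{z\in\mathbb C: e^{-1}\le |z|\le e\}$ be the connector annulus, regarded as the surface pair $(Q,\partial Q)$. A train track in $(Q,\partial Q)$ is a finite system of regular $C^1$ arcs (branches) in $Q$ with embedded, pairwise disjoint interiors lying in $\operatorname{int} Q$. Their ends either meet $\partial Q$ transversely, in pairwise different points, or meet at switches in $\operatorname{int} Q$. At each switch all branches share one tangent line, and there are branches on both sides. For a train track $\tau$ let $\mathscr V(\tau)$ be the cone of non-negative weights on the branches such that at each switch the total weights on the two sides agree, and let $\mathscr{PV}(\tau)=\{w\in\mathscr V(\tau):\sum_b w_b=1\}$ be its projectivization. Call $\tau$ full if $\mathscr V(\tau)$ contains a weight vector that is positive on every branch. Isotopies of train tracks are $C^1$-continuous families of train tracks in $(Q,\partial Q)$ with constant incidence of branches (end points on $\partial Q$ may slide in $\partial Q$). Let $\tau_1$ be the train track that consists of the core circle $|z|=1$, an arc from the outer boundary that merges tangentially with the circle at the switch $1$, and an arc that leaves the circle tangentially at the switch $-1$ towards the inner boundary, such that a smooth path coming from the outer boundary turns counterclockwise along the upper half circle from $1$ to $-1$, where it may leave to the inner boundary. Let $\tau_2$ be the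 mirror image of $\tau_1$ under complex conjugation. Let $\mathscr T$ consist of all full sub-train-tracks of $\tau_1$ and $\tau_2$ (including $\tau_1$ and $\tau_2$). Let $\mathscr M_{\mathscr T}(Q)$ be the quotient space of the disjoint union of the cones $\mathscr V(\tau)$, $\tau\in\mathscr T$, obtained by identifying, whenever two members of $\mathscr T$ share (up to isotopy) a full sub-train-track, the corresponding subcones; let $\mathscr{PM}_{\mathscr T}(Q)$ be constructed in the same way from the $\mathscr{PV}(\tau)$. Then: 1. For $i=1,2$, $\mathscr V(\tau_i)$ is parametrized bijectively by $(t_i,y_i)\in[0,\infty)^2$: both arcs have weight $y_i$, the half circle that a path follows from the outer arc to the inner arc has weight $t_i+y_i$, and the other half circle has weight $t_i$. 2. $\mathscr T$ is a closed collection: all its members are full, and each full sub-train-track of a member is isotopic to a member. 3. $\mathscr{PM}_{\mathscr T}(Q)$ is homeomorphic to $S^1$. 4. There is a piecewise linear homeomorphism $\Phi:\mathscr M_{\mathscr T}(Q)\to\mathbb R^2$ (that is, $\Phi$ is piecewise linear on each cone $\mathscr V(\tau)$, and $\mathbb R^2$ is a finite union of polyhedra on each of which $\Phi^{-1}$ is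 an affine map to one of the cones). The total weight $y$ induced on the outer boundary circle equals that induced on the inner one, is well defined on $\mathscr M_{\mathscr T}(Q)$, and $y\circ\Phi^{-1}$ is a piecewise linear function on $\mathbb R^2$. -/

import Mathlib

open Set Topology

noncomputable section

namespace Lam

/-! ### The connector annulus -/

/-- The connector annulus `Q`, as a closed round annulus around the unit circle. Its distinguished
boundary part `α` is all of `∂Q`, so that `δ` is empty. -/
def connector : Set ℂ := {z | Real.exp (-1) ≤ ‖z‖ ∧ ‖z‖ ≤ Real.exp 1}

def outerBoundary : Set ℂ := {z | ‖z‖ = Real.exp 1}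

def innerBoundary : Set ℂ := {z | ‖z‖ = Real.exp (-1)}

def connectorBoundary : Set ℂ := outerBoundary ∪ innerBoundary

/-! ### Train tracks embedded in the connector

A train track is given by finitely many branches (segments), each a regular `C¹` arc parametrized
by `[0, 1]`. The values of a parametrization outside `[0, 1]` play no role. An end of a branch `b`
is `(b, false)` (at parameter `0`) or `(b, true)` (at parameter `1`). -/

section Curves

variable {B : Type}

def endPoint (c : B → ℝ → ℂ) (e : B × Bool) : ℂ := c e.1 (if e.2 then 1 else 0)

/-- The tangent vector at an end of a branch, pointing into the branch. -/
def endDir (c : B → ℝ → ℂ) (e : B × Bool) : ℂ :=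
  if e.2 then -deriv (c e.1) 1 else deriv (c e.1) 0

/-- Two ends of branches at the same point, leaving it in the same direction. -/
def SameSide (c : B → ℝ → ℂ) (e e' : B × Bool) : Prop :=
  endPoint c e' = endPoint c e ∧ SameRay ℝ (endDir c e) (endDir c e')

/-- Two ends of branches at the same point, leaving it in opposite directions. -/
def OppositeSide (c : B → ℝ → ℂ) (e e' : B × Bool) : Prop :=
  endPoint c e' = endPoint c e ∧ SameRay ℝ (endDir c e) (-endDir c e')

/-- The arcs `c b`, `b : B`, are the branches of a train track `(τ, ∂τ) ↪ (Q, ∂Q)`. The switches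
are the end points of branches that do not lie on `∂Q`. -/
structure IsTrainTrack (c : B → ℝ → ℂ) : Prop where
  contDiff : ∀ b, ContDiff ℝ 1 (c b)
  immersed : ∀ b, ∀ u ∈ Icc (0 : ℝ) 1, deriv (c b) u ≠ 0
  mem_connector : ∀ b, ∀ u ∈ Icc (0 : ℝ) 1, c b u ∈ connector
  /-- branches meet the boundary of the annulus at most in their end points -/
  interior : ∀ b, ∀ u ∈ Ioo (0 : ℝ) 1, c b u ∉ connectorBoundary
  /-- the open branches are embedded, disjoint from each other and from all end points -/
  embedded : ∀ b b', ∀ u ∈ Ioo (0 : ℝ) 1, ∀ v ∈ Icc (0 : ℝ) 1, c b u = c b' v → b = b' ∧ u = v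
  /-- the track meets `∂Q` transversely (the radial component of the tangent is not zero) -/
  transverse : ∀ e, endPoint c e ∈ connectorBoundary → inner ℝ (endPoint c e) (endDir c e) ≠ 0
  /-- different ends of branches meet `∂Q` in different points -/
  boundary_inj : ∀ e e', endPoint c e ∈ connectorBoundary → endPoint c e' = endPoint c e → e' = e
  /-- all branches at a switch have the same tangent line there -/
  tangent : ∀ e e', endPoint c e' = endPoint c e → SameSide c e e' ∨ OppositeSide c e e'
  /-- there are branches on both sides of each switch -/
  two_sided : ∀ e, endPoint c e ∉ connectorBoundary → ∃ e', OppositeSide c e e'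

end Curves

/-- A train track embedded in the connector annulus `(Q, ∂Q)`. -/
structure TrainTrack where
  Branch : Type
  fintypeBranch : Fintype Branch
  curve : Branch → ℝ → ℂ
  isTrainTrack : IsTrainTrack curve

attribute [instance] TrainTrack.fintypeBranch

namespace TrainTrack

open Classical in
/-- The cone `𝒱(τ)` of invariant weight vectors: non-negative weights on the branches such that at
each switch the total weights on the two sides agree. -/
def weightCone (τ : TrainTrack) : Set (τ.Branch → ℝ) :=
  {w | (∀ b, 0 ≤ w b) ∧
    ∀ e : τ.Branch × Bool, endPoint τ.curve e ∉ connectorBoundary →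
      ∑ e' : τ.Branch × Bool with SameSide τ.curve e e', w e'.1 =
        ∑ e' : τ.Branch × Bool with OppositeSide τ.curve e e', w e'.1}

/-- The projectivized cone `𝒫𝒱(τ)`, as a convex polyhedron in the standard simplex. -/
def projWeightCone (τ : TrainTrack) : Set (τ.Branch → ℝ) :=
  {w | w ∈ τ.weightCone ∧ ∑ b, w b = 1}

open Classical in
/-- The weight that `w` induces on the part `X` of the boundary of the annulus. -/
def boundaryWeight (τ : TrainTrack) (X : Set ℂ) (w : τ.Branch → ℝ) : ℝ :=
  ∑ e : τ.Branch × Bool with endPoint τ.curve e ∈ X, w e.1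

/-- `τ` is full: some measured lamination is carried by `τ` with positive weight on each branch. -/
def IsFull (τ : TrainTrack) : Prop := ∃ w ∈ τ.weightCone, ∀ b, 0 < w b

/-- The union of a set of branches is a sub-train-track if it is itself a train track. -/
def IsSubtrack (τ : TrainTrack) (A : Finset τ.Branch) : Prop :=
  IsTrainTrack fun b : A => τ.curve b

def sub (τ : TrainTrack) (A : Finset τ.Branch) (h : τ.IsSubtrack A) : TrainTrack where
  Branch := A
  fintypeBranch := inferInstance
  curve b := τ.curve b
  isTrainTrack := h

def IsFullSubtrack (τ : TrainTrack) (A : Finset τ.Branch) : Prop :=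
  ∃ h : τ.IsSubtrack A, (τ.sub A h).IsFull

/-- An isotopy in `(Q, ∂Q)` from `σ` to `τ`: a `C¹`-continuous family of embedded train tracks with
constant incidence of branches, which starts with `σ` and ends with `τ`. End points on `∂Q` may
move in `∂Q`. At the end, branches are matched as subsets of the annulus. -/
structure Isotopy (σ τ : TrainTrack) where
  family : ℝ → σ.Branch → ℝ → ℂ
  branchEquiv : σ.Branch ≃ τ.Branch
  isTrainTrack : ∀ s ∈ Icc (0 : ℝ) 1, IsTrainTrack (family s)
  continuousOn : ∀ b,
    ContinuousOn (fun p : ℝ × ℝ => family p.1 b p.2) (Icc (0 : ℝ) 1 ×ˢ Icc (0 : ℝ) 1)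
  continuousOn_deriv : ∀ b,
    ContinuousOn (fun p : ℝ × ℝ => deriv (family p.1 b) p.2) (Icc (0 : ℝ) 1 ×ˢ Icc (0 : ℝ) 1)
  incidence : ∀ s ∈ Icc (0 : ℝ) 1, ∀ e e',
    endPoint (family s) e = endPoint (family s) e' ↔ endPoint σ.curve e = endPoint σ.curve e'
  start : ∀ b, ∀ u ∈ Icc (0 : ℝ) 1, family 0 b u = σ.curve b u
  finish : ∀ b, family 1 b '' Icc 0 1 = τ.curve (branchEquiv b) '' Icc 0 1

end TrainTrack

/-! ### Collections of train tracks and their lamination spaces -/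

section Collections

variable {ι : Type} (𝒯 : ι → TrainTrack)

/-- A collection of full train tracks is closed if it contains, up to isotopy, all full
sub-train-tracks of its members. -/
def IsClosedCollection : Prop :=
  (∀ i, (𝒯 i).IsFull) ∧
    ∀ i (A : Finset (𝒯 i).Branch) (h : (𝒯 i).IsSubtrack A), ((𝒯 i).sub A h).IsFull →
      ∃ j, Nonempty (((𝒯 i).sub A h).Isotopy (𝒯 j))

/-- The weight vectors `v` on `𝒯 i` and `w` on `𝒯 j` come from the same weight vector on a full
sub-train-track that `𝒯 i` and `𝒯 j` share up to isotopy. -/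
def Glue (i j : ι) (v : (𝒯 i).Branch → ℝ) (w : (𝒯 j).Branch → ℝ) : Prop :=
  ∃ (A : Finset (𝒯 i).Branch) (B : Finset (𝒯 j).Branch)
    (hA : (𝒯 i).IsSubtrack A) (hB : (𝒯 j).IsSubtrack B)
    (φ : ((𝒯 i).sub A hA).Isotopy ((𝒯 j).sub B hB)),
    ((𝒯 i).sub A hA).IsFull ∧ ((𝒯 j).sub B hB).IsFull ∧
    (∀ b, b ∉ A → v b = 0) ∧ (∀ b, b ∉ B → w b = 0) ∧
    ∀ a : A, w (show B from φ.branchEquiv a).1 = v a.1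

/-- `ℳ_𝒯`: the disjoint union of the cones `𝒱(τ)`, `τ ∈ 𝒯`, glued along the subcones of common
full sub-train-tracks, with the quotient topology. (`Quot` is the quotient by the equivalence
relation generated by the given one.) -/
def MLSpace : Type :=
  Quot fun x y : Σ i, (𝒯 i).weightCone => Glue 𝒯 x.1 y.1 (x.2 : _ → ℝ) (y.2 : _ → ℝ)

instance : TopologicalSpace (MLSpace 𝒯) :=
  inferInstanceAs (TopologicalSpace (Quot _))

/-- `𝒫ℳ_𝒯`: the same construction with the polyhedra `𝒫𝒱(τ)`. -/
def PMLSpace : Type :=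
  Quot fun x y : Σ i, (𝒯 i).projWeightCone => Glue 𝒯 x.1 y.1 (x.2 : _ → ℝ) (y.2 : _ → ℝ)

instance : TopologicalSpace (PMLSpace 𝒯) :=
  inferInstanceAs (TopologicalSpace (Quot _))

/-- The measured lamination `τ(w)`, as a point of `ℳ_𝒯`. -/
def MLSpace.mk (i : ι) (w : (𝒯 i).weightCone) : MLSpace 𝒯 := Quot.mk _ ⟨i, w⟩

end Collections

/-- The collection of all full sub-train-tracks of the given train tracks. -/
def fullSubtracks {κ : Type} (τ : κ → TrainTrack) :
    (Σ k, {A : Finset (τ k).Branch // (τ k).IsFullSubtrack A}) → TrainTrack :=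
  fun x => (τ x.1).sub x.2.1 x.2.2.1

/-! ### Piecewise linear maps -/

section PL

variable {E F : Type} [NormedAddCommGroup E] [NormedSpace ℝ E]
  [NormedAddCommGroup F] [NormedSpace ℝ F]

/-- A (convex) polyhedron: the intersection of finitely many closed half-spaces. -/
def IsPolyhedron (P : Set E) : Prop :=
  ∃ H : Finset ((E →L[ℝ] ℝ) × ℝ), P = {x | ∀ h ∈ H, h.1 x ≤ h.2}

/-- `f : X → F` is piecewise linear: it is continuous, and `X` is a finite union of polyhedra on
each of which `f` is affine. -/
def IsPiecewiseLinear {X : Set E} (f : X → F) : Prop :=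
  Continuous f ∧ ∃ 𝒬 : Finset (Set E), (∀ P ∈ 𝒬, IsPolyhedron P) ∧ (⋃ P ∈ 𝒬, P) = X ∧
    ∀ P ∈ 𝒬, ∃ L : E →ᵃ[ℝ] F, ∀ x : X, (x : E) ∈ P → f x = L x

/-- A homeomorphism `ℳ_𝒯 ≃ E` is piecewise linear: it is piecewise linear on each cone `𝒱(τ)`, and
`E` is a finite union of polyhedra on each of which the inverse is an affine map to some cone. -/
def IsPLHomeomorph {ι : Type} {𝒯 : ι → TrainTrack} (Φ : MLSpace 𝒯 ≃ₜ E) : Prop :=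
  (∀ i, IsPiecewiseLinear fun w : (𝒯 i).weightCone => Φ (MLSpace.mk 𝒯 i w)) ∧
    ∃ 𝒬 : Finset (Set E), (∀ P ∈ 𝒬, IsPolyhedron P) ∧ (⋃ P ∈ 𝒬, P) = univ ∧
      ∀ P ∈ 𝒬, ∃ (i : ι) (L : E →ᵃ[ℝ] ((𝒯 i).Branch → ℝ)), ∀ x ∈ P,
        ∃ h : L x ∈ (𝒯 i).weightCone, Φ.symm x = MLSpace.mk 𝒯 i ⟨L x, h⟩

end PL

/-! ### The two standard train tracks in the connector

Both consist of the core circle, divided by the switches `1` and `-1` into two half circles, an arc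
from the outer boundary which merges tangentially with the circle at `1`, and an arc which leaves
the circle tangentially at `-1` towards the inner boundary. A path that comes in from the outer
boundary turns counterclockwise in one of the tracks and clockwise in the other one; `long` is the
half circle that it runs along to get from `1` to `-1`, and `short` the other half circle. -/

inductive ConnectorBranch
  | outer | inner | long | short
  deriving DecidableEq

instance : Fintype ConnectorBranch :=
  ⟨{.outer, .inner, .long, .short}, fun b => by cases b <;> decide⟩

/-- The point with polar coordinates `(exp s, θ)`. -/
def polar (s θ : ℝ) : ℂ := Complex.exp (s + θ * Complex.I)

/-- The sense of turning: counterclockwise for `false`, clockwise for `true`. -/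
def turn (k : Bool) : ℝ := if k then -1 else 1

def connectorCurve (k : Bool) : ConnectorBranch → ℝ → ℂ
  | .outer => fun u => polar (u ^ 2) (turn k * -u)
  | .inner => fun u => polar (-u ^ 2) (turn k * (Real.pi + u))
  | .long => fun u => polar 0 (turn k * (Real.pi * u))
  | .short => fun u => polar 0 (turn k * (Real.pi * (1 + u)))

theorem norm_polar (s θ : ℝ) : ‖polar s θ‖ = Real.exp s := by
  simp [polar, Complex.norm_exp]

theorem polar_im (s θ : ℝ) : (polar s θ).im = Real.exp s * Real.sin θ := by
  simp [polar, Complex.exp_im]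

theorem polar_re (s θ : ℝ) : (polar s θ).re = Real.exp s * Real.cos θ := by
  simp [polar, Complex.exp_re]

theorem turn_cases (k : Bool) : turn k = 1 ∨ turn k = -1 := by
  cases k <;> simp [turn]

theorem polar_ne_zero (s θ : ℝ) : polar s θ ≠ 0 := Complex.exp_ne_zero _

theorem hasDerivAt_polar {f g : ℝ → ℝ} {f' g' u : ℝ} (hf : HasDerivAt f f' u)
    (hg : HasDerivAt g g' u) :
    HasDerivAt (fun u => polar (f u) (g u)) (polar (f u) (g u) * (f' + g' * Complex.I)) u := by
  have := ((hf.ofReal_comp).add ((hg.ofReal_comp).mul_const Complex.I)).cexp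
  exact this

theorem contDiff_polar {f g : ℝ → ℝ} (hf : ContDiff ℝ 1 f) (hg : ContDiff ℝ 1 g) :
    ContDiff ℝ 1 (fun u => polar (f u) (g u)) := by
  have h : ContDiff ℝ 1 (fun x : ℝ => (x : ℂ)) := Complex.ofRealCLM.contDiff
  exact ((h.comp hf).add ((h.comp hg).mul contDiff_const)).cexp

/-- The logarithmic radial velocity and the angular velocity of the branches. -/
def radialSpeed : ConnectorBranch → ℝ → ℝ
  | .outer, u => 2 * u
  | .inner, u => -(2 * u)
  | .long, _ => 0
  | .short, _ => 0

def angularSpeed (k : Bool) : ConnectorBranch → ℝ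
  | .outer => -turn k
  | .inner => turn k
  | .long => turn k * Real.pi
  | .short => turn k * Real.pi

theorem deriv_connectorCurve (k : Bool) (b : ConnectorBranch) (u : ℝ) :
    deriv (connectorCurve k b) u =
      connectorCurve k b u * (radialSpeed b u + angularSpeed k b * Complex.I) := by
  have hi := hasDerivAt_id u
  have hsq : HasDerivAt (fun u : ℝ => u ^ 2) (2 * u) u := by simpa using hasDerivAt_pow 2 u
  cases b
  · have hg : HasDerivAt (fun u : ℝ => turn k * -u) (-turn k) u := by
      simpa using hi.neg.const_mul (turn k)
    exact (hasDerivAt_polar hsq hg).deriv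
  · have hg : HasDerivAt (fun u : ℝ => turn k * (Real.pi + u)) (turn k) u := by
      simpa using (hi.const_add Real.pi).const_mul (turn k)
    exact (hasDerivAt_polar hsq.neg hg).deriv
  · have hg : HasDerivAt (fun u : ℝ => turn k * (Real.pi * u)) (turn k * Real.pi) u := by
      simpa using (hi.const_mul Real.pi).const_mul (turn k)
    exact (hasDerivAt_polar (hasDerivAt_const u (0 : ℝ)) hg).deriv
  · have hg : HasDerivAt (fun u : ℝ => turn k * (Real.pi * (1 + u))) (turn k * Real.pi) u := by
      simpa using ((hi.const_add 1).const_mul Real.pi).const_mul (turn k)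
    exact (hasDerivAt_polar (hasDerivAt_const u (0 : ℝ)) hg).deriv

theorem norm_connectorCurve (k : Bool) (b : ConnectorBranch) (u : ℝ) :
    ‖connectorCurve k b u‖ = Real.exp (match b with
      | .outer => u ^ 2 | .inner => -u ^ 2 | .long => 0 | .short => 0) := by
  cases b <;> exact norm_polar _ _

theorem im_long (k : Bool) (u : ℝ) :
    (connectorCurve k .long u).im = turn k * Real.sin (Real.pi * u) := by
  rw [connectorCurve, polar_im]
  rcases turn_cases k with h | h <;> simp [h]

theorem im_short (k : Bool) (u : ℝ) :
    (connectorCurve k .short u).im = -(turn k * Real.sin (Real.pi * u)) := by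
  have h1 : Real.sin (Real.pi * (1 + u)) = -Real.sin (Real.pi * u) := by
    rw [mul_add, mul_one, add_comm, Real.sin_add_pi]
  rw [connectorCurve, polar_im]
  rcases turn_cases k with h | h <;> simp [h, h1]

theorem re_long (k : Bool) (u : ℝ) :
    (connectorCurve k .long u).re = Real.cos (Real.pi * u) := by
  rw [connectorCurve, polar_re]
  rcases turn_cases k with h | h <;> simp [h]

theorem re_short (k : Bool) (u : ℝ) :
    (connectorCurve k .short u).re = -Real.cos (Real.pi * u) := by
  have h1 : Real.cos (Real.pi * (1 + u)) = -Real.cos (Real.pi * u) := by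
    rw [mul_add, mul_one, add_comm, Real.cos_add_pi]
  rw [connectorCurve, polar_re]
  rcases turn_cases k with h | h <;> simp [h, h1]

theorem outer_zero (k : Bool) : connectorCurve k .outer 0 = 1 := by
  simp [connectorCurve, polar]

theorem inner_zero (k : Bool) : connectorCurve k .inner 0 = -1 := by
  rcases turn_cases k with h | h <;> simp [connectorCurve, polar, h, Complex.exp_neg]

theorem long_zero (k : Bool) : connectorCurve k .long 0 = 1 := by
  simp [connectorCurve, polar]

theorem long_one (k : Bool) : connectorCurve k .long 1 = -1 := by
  apply Complex.ext <;> simp [re_long, im_long]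

theorem short_zero (k : Bool) : connectorCurve k .short 0 = -1 := by
  apply Complex.ext <;> simp [re_short, im_short]

theorem short_one (k : Bool) : connectorCurve k .short 1 = 1 := by
  apply Complex.ext <;> simp [re_short, im_short]

/-- The velocity at an end of a branch at a switch is this multiple of `i` (up to `turn k`). -/
def endSpeed : ConnectorBranch × Bool → ℝ
  | (.outer, _) => -1
  | (.inner, _) => -1
  | (.long, _) => Real.pi
  | (.short, _) => -Real.pi

theorem sameRay_mul_I {a b : ℝ} (h : 0 < a * b) :
    SameRay ℝ ((a : ℂ) * Complex.I) ((b : ℂ) * Complex.I) := by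
  have hab : SameRay ℝ a b := by
    rcases pos_and_pos_or_neg_and_neg_of_mul_pos h with ⟨ha, hb⟩ | ⟨ha, hb⟩
    · exact Or.inr (Or.inr ⟨b, a, hb, ha, by simp [mul_comm]⟩)
    · exact Or.inr (Or.inr ⟨-b, -a, by linarith, by linarith, by simp [mul_comm]⟩)
  have := hab.map (LinearMap.toSpanSingleton ℝ ℂ Complex.I)
  simpa using this

theorem mem_boundary_iff (k : Bool) (e : ConnectorBranch × Bool) :
    endPoint (connectorCurve k) e ∈ connectorBoundary ↔ e = (.outer, true) ∨ e = (.inner, true) := by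
  have h1 : (1 : ℝ) ≠ Real.exp 1 := by
    intro h
    have := (Real.exp_eq_one_iff 1).1 h.symm
    norm_num at this
  have h2 : (1 : ℝ) ≠ Real.exp (-1) := by
    intro h
    have := (Real.exp_eq_one_iff (-1)).1 h.symm
    norm_num at this
  rcases e with ⟨b, _ | _⟩ <;> cases b <;>
    simp [endPoint, connectorBoundary, outerBoundary, innerBoundary, norm_connectorCurve, h1, h2]

theorem endDir_switch (k : Bool) (e : ConnectorBranch × Bool)
    (he : endPoint (connectorCurve k) e ∉ connectorBoundary) :
    endDir (connectorCurve k) e = ((turn k * endSpeed e : ℝ) : ℂ) * Complex.I := by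
  rw [mem_boundary_iff] at he
  rcases e with ⟨b, _ | _⟩ <;> cases b <;>
    simp [endDir, deriv_connectorCurve, outer_zero, inner_zero, long_zero, long_one, short_zero,
      short_one, radialSpeed, angularSpeed, endSpeed] at he ⊢

theorem turn_mul_self (k : Bool) : turn k * turn k = 1 := by
  rcases turn_cases k with h | h <;> simp [h]

theorem sameRay_endDir (k : Bool) (e e' : ConnectorBranch × Bool)
    (he : endPoint (connectorCurve k) e ∉ connectorBoundary)
    (he' : endPoint (connectorCurve k) e' ∉ connectorBoundary)
    (h : 0 < endSpeed e * endSpeed e') :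
    SameRay ℝ (endDir (connectorCurve k) e) (endDir (connectorCurve k) e') := by
  rw [endDir_switch k e he, endDir_switch k e' he']
  apply sameRay_mul_I
  have : turn k * endSpeed e * (turn k * endSpeed e') =
    turn k * turn k * (endSpeed e * endSpeed e') := by ring
  rw [this, turn_mul_self, one_mul]
  exact h

theorem sameRay_neg_endDir (k : Bool) (e e' : ConnectorBranch × Bool)
    (he : endPoint (connectorCurve k) e ∉ connectorBoundary)
    (he' : endPoint (connectorCurve k) e' ∉ connectorBoundary)
    (h : endSpeed e * endSpeed e' < 0) :
    SameRay ℝ (endDir (connectorCurve k) e) (-endDir (connectorCurve k) e') := by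
  rw [endDir_switch k e he, endDir_switch k e' he']
  have : turn k * endSpeed e * -(turn k * endSpeed e') =
    turn k * turn k * -(endSpeed e * endSpeed e') := by ring
  have h2 := @sameRay_mul_I (turn k * endSpeed e) (-(turn k * endSpeed e'))
    (by rw [this, turn_mul_self, one_mul]; linarith)
  simpa using h2

theorem endSpeed_ne_zero (e : ConnectorBranch × Bool) : endSpeed e ≠ 0 := by
  rcases e with ⟨b, _ | _⟩ <;> cases b <;> simp [endSpeed, Real.pi_ne_zero]

theorem sin_pi_mul_pos {u : ℝ} (hu : u ∈ Ioo (0 : ℝ) 1) : 0 < Real.sin (Real.pi * u) :=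
  Real.sin_pos_of_pos_of_lt_pi (mul_pos Real.pi_pos hu.1) (by nlinarith [Real.pi_pos, hu.2])

theorem sin_pi_mul_nonneg {u : ℝ} (hu : u ∈ Icc (0 : ℝ) 1) : 0 ≤ Real.sin (Real.pi * u) :=
  Real.sin_nonneg_of_nonneg_of_le_pi (mul_nonneg Real.pi_pos.le hu.1)
    (by nlinarith [Real.pi_pos, hu.2])

theorem cos_pi_mul_inj {u v : ℝ} (hu : u ∈ Icc (0 : ℝ) 1) (hv : v ∈ Icc (0 : ℝ) 1)
    (h : Real.cos (Real.pi * u) = Real.cos (Real.pi * v)) : u = v := by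
  have hp := Real.pi_pos
  have := Real.injOn_cos ⟨mul_nonneg hp.le hu.1, by nlinarith [hu.2]⟩
    ⟨mul_nonneg hp.le hv.1, by nlinarith [hv.2]⟩ h
  exact mul_left_cancel₀ hp.ne' this

theorem connectorCurve_embedded (k : Bool) (b b' : ConnectorBranch) (u : ℝ)
    (hu : u ∈ Ioo (0 : ℝ) 1) (v : ℝ) (hv : v ∈ Icc (0 : ℝ) 1)
    (h : connectorCurve k b u = connectorCurve k b' v) : b = b' ∧ u = v := by
  have hn := congrArg norm h
  have hre := congrArg Complex.re h
  have him := congrArg Complex.im h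
  have hu2 : 0 < u ^ 2 := pow_pos hu.1 2
  have hv2 : 0 ≤ v ^ 2 := sq_nonneg v
  have hs := sin_pi_mul_pos hu
  have hsv := sin_pi_mul_nonneg hv
  have ht := turn_mul_self k
  have hu' : u ∈ Icc (0 : ℝ) 1 := ⟨hu.1.le, hu.2.le⟩
  have ht0 : turn k ≠ 0 := by rintro h0; simp [h0] at ht
  rw [norm_connectorCurve, norm_connectorCurve, Real.exp_eq_exp] at hn
  have sq0 : v ^ 2 = 0 → v = 0 := fun h => by simpa using h
  have sqi : u ^ 2 = v ^ 2 → u = v := fun h => by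
    rwa [sq_eq_sq₀ hu.1.le hv.1] at h
  cases b <;> cases b' <;> simp only at hn
  · exact ⟨rfl, sqi hn⟩
  · linarith
  · linarith
  · linarith
  · linarith
  · exact ⟨rfl, sqi (by linarith)⟩
  · linarith
  · linarith
  · have := sq0 hn.symm; subst this
    rw [im_long, outer_zero] at him
    simp [ht0, hs.ne'] at him
  · have := sq0 (by linarith); subst this
    rw [im_long, inner_zero] at him
    simp [ht0, hs.ne'] at him
  · rw [re_long, re_long] at hre
    exact ⟨rfl, cos_pi_mul_inj hu' hv hre⟩
  · rw [im_long, im_short, ← mul_neg] at him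
    have := mul_left_cancel₀ ht0 him
    linarith
  · have := sq0 hn.symm; subst this
    rw [im_short, outer_zero] at him
    simp [ht0, hs.ne'] at him
  · have := sq0 (by linarith); subst this
    rw [im_short, inner_zero] at him
    simp [ht0, hs.ne'] at him
  · rw [im_long, im_short, ← mul_neg] at him
    have := mul_left_cancel₀ ht0 him
    linarith
  · rw [re_short, re_short] at hre
    exact ⟨rfl, cos_pi_mul_inj hu' hv (neg_injective hre)⟩

theorem connectorCurve_isTrainTrack (k : Bool) : IsTrainTrack (connectorCurve k) where
  contDiff b := by
    cases b <;> exact contDiff_polar (by fun_prop) (by fun_prop)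
  immersed b u hu := by
    rw [deriv_connectorCurve]
    refine mul_ne_zero ?_ ?_
    · cases b <;> exact polar_ne_zero _ _
    · intro h
      have h2 := congrArg Complex.im h
      rcases turn_cases k with ht | ht <;> cases b <;>
        simp [angularSpeed, ht, Real.pi_ne_zero] at h2
  mem_connector b u hu := by
    have h1 : u ^ 2 ≤ 1 := by nlinarith [hu.1, hu.2]
    have h2 := sq_nonneg u
    simp only [connector, mem_ofPred_eq, norm_connectorCurve, Real.exp_le_exp]
    cases b <;> constructor <;> simp only <;> linarith
  interior b u hu := by
    have h1 : u ^ 2 < 1 := by nlinarith [hu.1, hu.2]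
    have h2 := sq_nonneg u
    simp only [connectorBoundary, outerBoundary, innerBoundary, mem_union, mem_ofPred_eq,
      norm_connectorCurve, Real.exp_eq_exp]
    rintro (h | h) <;> cases b <;> simp only at h <;> linarith
  embedded b b' u hu v hv h := connectorCurve_embedded k b b' u hu v hv h
  transverse e he := by
    have key : ∀ (z : ℂ) (r a : ℝ), z ≠ 0 → r ≠ 0 →
        inner ℝ z (-(z * (r + a * Complex.I))) ≠ 0 := by
      intro z r a hz hr
      have : inner ℝ z (-(z * (r + a * Complex.I))) = -(r * Complex.normSq z) := by
        simp [Complex.inner, Complex.normSq_apply]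
        ring
      rw [this]
      exact neg_ne_zero.2 (mul_ne_zero hr (by simpa using hz))
    rcases (mem_boundary_iff k e).1 he with rfl | rfl
    · simp only [endPoint, endDir, if_true, deriv_connectorCurve]
      exact key _ _ _ (polar_ne_zero _ _) (by simp [radialSpeed])
    · simp only [endPoint, endDir, if_true, deriv_connectorCurve]
      exact key _ _ _ (polar_ne_zero _ _) (by simp [radialSpeed])
  boundary_inj e e' he h := by
    have he' := he
    rw [← h] at he'
    have hn := congrArg norm h
    rcases (mem_boundary_iff k e).1 he with rfl | rfl <;>
      rcases (mem_boundary_iff k e').1 he' with rfl | rfl <;> try rfl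
    all_goals
      simp only [endPoint, if_true, norm_connectorCurve, Real.exp_eq_exp] at hn
      norm_num at hn
  tangent e e' h := by
    by_cases he : endPoint (connectorCurve k) e ∈ connectorBoundary
    · have he' := he
      rw [← h] at he'
      have hn := congrArg norm h
      left
      rcases (mem_boundary_iff k e).1 he with rfl | rfl <;>
        rcases (mem_boundary_iff k e').1 he' with rfl | rfl <;>
        first
        | exact ⟨rfl, SameRay.refl _⟩
        | (simp only [endPoint, if_true, norm_connectorCurve, Real.exp_eq_exp] at hn
           norm_num at hn)
    · have he' := he
      rw [← h] at he'
      rcases lt_or_gt_of_ne (mul_ne_zero (endSpeed_ne_zero e) (endSpeed_ne_zero e')) with h0 | h0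
      · exact Or.inr ⟨h, sameRay_neg_endDir k e e' he he' h0⟩
      · exact Or.inl ⟨h, sameRay_endDir k e e' he he' h0⟩
  two_sided e he := by
    have key : ∀ e', endPoint (connectorCurve k) e' = endPoint (connectorCurve k) e →
        endSpeed e * endSpeed e' < 0 → ∃ e', OppositeSide (connectorCurve k) e e' :=
      fun e' h h0 => ⟨e', h, sameRay_neg_endDir k e e' he (by rwa [h]) h0⟩
    have hp := Real.pi_pos
    have hb := mt (mem_boundary_iff k e).2 he
    rcases e with ⟨b, _ | _⟩ <;> cases b
    · exact key (.long, false) (by simp [endPoint, outer_zero, long_zero])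
        (by simp only [endSpeed]; nlinarith)
    · exact key (.long, true) (by simp [endPoint, inner_zero, long_one])
        (by simp only [endSpeed]; nlinarith)
    · exact key (.outer, false) (by simp [endPoint, outer_zero, long_zero])
        (by simp only [endSpeed]; nlinarith)
    · exact key (.long, true) (by simp [endPoint, short_zero, long_one])
        (by simp only [endSpeed]; nlinarith)
    · simp at hb
    · simp at hb
    · exact key (.inner, false) (by simp [endPoint, inner_zero, long_one])
        (by simp only [endSpeed]; nlinarith)
    · exact key (.long, false) (by simp [endPoint, short_one, long_zero])
        (by simp only [endSpeed]; nlinarith)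

/-- The two standard train tracks in the connector annulus. -/
def connectorTrack (k : Bool) : TrainTrack where
  Branch := ConnectorBranch
  fintypeBranch := inferInstance
  curve := connectorCurve k
  isTrainTrack := connectorCurve_isTrainTrack k

/-- The weights on the branches of a standard train track with parameters `(t, y)`. -/
def connectorWeight (t y : ℝ) : ConnectorBranch → ℝ
  | .outer => y
  | .inner => y
  | .long => t + y
  | .short => t

/-- The two standard train tracks together with all their full sub-train-tracks. -/
abbrev connectorCollection := fullSubtracks connectorTrack

end Lam

/-!
By the switch conditions, each cone `𝒱(τᵢ)` is a quadrant with coordinates `(t, y)`. Its boundary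
rays carry the core circle and the simple arc that crosses the annulus. The two core circles
coincide, and the two arcs are isotopic: one of them can be unwound to a radial arc and wound up to
the other side, if it is slanted in between to run strictly inwards, which keeps it embedded. Hence
the two quadrants are glued along both boundary rays. Nothing else is identified: the smooth core
circle can be recovered from a train track that carries all branches, and its winding number,
oriented by the way in which a path turns from the outer to the inner boundary, is constant during
an isotopy, so the sense of turning is an invariant. Therefore `(t, y) ↦ (t - y, ± min t y)`
identifies the glued cones with the plane, and the projectivized cones with a level set of a
positively homogeneous function, which is a circle.
-/

namespace Lam

/-! ### Train tracks and their weight cones -/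

section Curves

variable {B B' : Type} {c : B → ℝ → ℂ}

theorem IsTrainTrack.comp_injective (h : IsTrainTrack c) {f : B' → B} (hf : Function.Injective f)
    (two_sided : ∀ e, endPoint (fun b => c (f b)) e ∉ connectorBoundary →
      ∃ e', OppositeSide (fun b => c (f b)) e e') :
    IsTrainTrack fun b => c (f b) where
  contDiff b := h.contDiff (f b)
  immersed b := h.immersed (f b)
  mem_connector b := h.mem_connector (f b)
  interior b := h.interior (f b)
  embedded b b' u hu v hv hb :=
    (h.embedded (f b) (f b') u hu v hv hb).imp (fun h => hf h) id
  transverse e := h.transverse (f e.1, e.2)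
  boundary_inj e e' he hee :=
    (hf.prodMap Function.injective_id) (h.boundary_inj (f e.1, e.2) (f e'.1, e'.2) he hee)
  tangent e e' := h.tangent (f e.1, e.2) (f e'.1, e'.2)
  two_sided := two_sided

theorem IsTrainTrack.comp_equiv (h : IsTrainTrack c) (f : B' ≃ B) :
    IsTrainTrack fun b => c (f b) :=
  h.comp_injective f.injective fun e he => by
    obtain ⟨e', he'⟩ := h.two_sided (f e.1, e.2) he
    refine ⟨(f.symm e'.1, e'.2), ?_⟩
    simpa [OppositeSide, endPoint, endDir] using he'

theorem SameSide.refl (e : B × Bool) : SameSide c e e := ⟨rfl, SameRay.refl _⟩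

theorem IsTrainTrack.endDir_ne_zero (h : IsTrainTrack c) (e : B × Bool) : endDir c e ≠ 0 := by
  rcases e with ⟨b, _ | _⟩
  · simpa [endDir] using h.immersed b 0 (by simp)
  · simpa [endDir] using h.immersed b 1 (by simp)

theorem IsTrainTrack.not_sameSide_and_oppositeSide (h : IsTrainTrack c) (e e' : B × Bool) :
    ¬ (SameSide c e e' ∧ OppositeSide c e e') := by
  rintro ⟨hs, ho⟩
  have hray := hs.2.symm.trans ho.2 fun h0 => absurd h0 (h.endDir_ne_zero e)
  exact h.endDir_ne_zero e' (eq_zero_of_sameRay_self_neg hray)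

theorem IsTrainTrack.endPoint_mem_connectorBoundary_iff (h : IsTrainTrack c) (e : B × Bool) :
    endPoint c e ∈ connectorBoundary ↔ ∀ e', endPoint c e' = endPoint c e → e' = e := by
  refine ⟨fun he e' => h.boundary_inj e e' he, fun he => ?_⟩
  by_contra hb
  obtain ⟨e', he'⟩ := h.two_sided e hb
  obtain rfl := he e' he'.1
  exact h.not_sameSide_and_oppositeSide e' e' ⟨.refl _, he'⟩

theorem sameRay_congr_left {u v w : ℂ} (hu : u ≠ 0) (hv : v ≠ 0) (huv : SameRay ℝ u v) :
    SameRay ℝ u w ↔ SameRay ℝ v w :=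
  ⟨fun h => huv.symm.trans h fun h0 => absurd h0 hu, fun h => huv.trans h fun h0 => absurd h0 hv⟩

theorem IsTrainTrack.sides_eq_of_sameSide (h : IsTrainTrack c)
    {e e' : B × Bool} (he : SameSide c e e') :
    SameSide c e = SameSide c e' ∧ OppositeSide c e = OppositeSide c e' := by
  constructor <;> ext x <;> simp only [SameSide, OppositeSide, he.1,
    sameRay_congr_left (h.endDir_ne_zero e) (h.endDir_ne_zero e') he.2]

theorem IsTrainTrack.sides_swap_of_oppositeSide (h : IsTrainTrack c)
    {e e' : B × Bool} (he : OppositeSide c e e') :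
    SameSide c e = OppositeSide c e' ∧ OppositeSide c e = SameSide c e' := by
  have hne := neg_ne_zero.2 (h.endDir_ne_zero e')
  constructor <;> ext x <;> simp only [SameSide, OppositeSide, he.1,
    sameRay_congr_left (h.endDir_ne_zero e) hne he.2, sameRay_neg_swap, neg_neg]

variable [Fintype B] [Fintype B']

open Classical in
/-- The switch condition for the weights `w` at the end `e` of a branch: the total weights of the
ends on the same and on the opposite side of the switch agree. -/
def IsBalancedAt (c : B → ℝ → ℂ) (w : B → ℝ) (e : B × Bool) : Prop :=
  ∑ e' : B × Bool with SameSide c e e', w e'.1 = ∑ e' : B × Bool with OppositeSide c e e', w e'.1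

theorem IsTrainTrack.isBalancedAt_congr (h : IsTrainTrack c) (w : B → ℝ) {e e' : B × Bool}
    (he : endPoint c e' = endPoint c e) : IsBalancedAt c w e ↔ IsBalancedAt c w e' := by
  unfold IsBalancedAt
  rcases h.tangent e e' he with hs | ho
  · obtain ⟨hsame, hopp⟩ := h.sides_eq_of_sameSide hs
    rw [hsame, hopp]
  · obtain ⟨hsame, hopp⟩ := h.sides_swap_of_oppositeSide ho
    rw [hsame, hopp, eq_comm]

theorem IsBalancedAt.exists_oppositeSide_pos {w : B → ℝ} (hw : ∀ b, 0 ≤ w b) {e : B × Bool}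
    (he : 0 < w e.1) (h : IsBalancedAt c w e) : ∃ e', OppositeSide c e e' ∧ 0 < w e'.1 := by
  classical
  have hpos : 0 < ∑ e' : B × Bool with OppositeSide c e e', w e'.1 :=
    h ▸ he.trans_le (Finset.single_le_sum (f := fun e' : B × Bool => w e'.1) (fun _ _ => hw _)
      (Finset.mem_filter.2 ⟨Finset.mem_univ e, .refl e⟩))
  obtain ⟨e', he', h0⟩ := Finset.exists_lt_of_sum_lt (f := fun _ => (0 : ℝ)) (by simpa using hpos)
  exact ⟨e', (Finset.mem_filter.1 he').2, h0⟩

open Classical in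
theorem sum_filter_extend_zero {f : B' → B} (hf : Function.Injective f) (w : B' → ℝ)
    (p : B × Bool → Prop) :
    ∑ e : B' × Bool with p (f e.1, e.2), w e.1 =
      ∑ e : B × Bool with p e, Function.extend f w 0 e.1 := by
  rw [Finset.sum_filter, Finset.sum_filter]
  refine Fintype.sum_of_injective (Prod.map f id) (hf.prodMap Function.injective_id) _ _
    (fun e he => ?_) fun e => ?_
  · have : ¬ ∃ b, f b = e.1 := fun ⟨b, hb⟩ => he ⟨(b, e.2), Prod.ext hb rfl⟩
    simp [Function.extend_apply' w _ e.1 this]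
  · simp [Prod.map, hf.extend_apply]

theorem isBalancedAt_extend_zero_iff {f : B' → B} (hf : Function.Injective f) (w : B' → ℝ)
    (e : B' × Bool) : IsBalancedAt c (Function.extend f w 0) (f e.1, e.2) ↔
      IsBalancedAt (fun b => c (f b)) w e := by
  unfold IsBalancedAt
  rw [← sum_filter_extend_zero hf, ← sum_filter_extend_zero hf]
  rfl

end Curves

namespace TrainTrack

variable {σ τ : TrainTrack} {f : σ.Branch → τ.Branch}

theorem extend_zero_mem_weightCone_iff (hf : Function.Injective f)
    (hc : ∀ b, σ.curve b = τ.curve (f b)) (w : σ.Branch → ℝ) :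
    Function.extend f w 0 ∈ τ.weightCone ↔ w ∈ σ.weightCone := by
  classical
  have hσ : σ.curve = fun b => τ.curve (f b) := funext hc
  have balanced_iff : ∀ e, IsBalancedAt τ.curve (Function.extend f w 0) (f e.1, e.2) ↔
      IsBalancedAt σ.curve w e := hσ ▸ isBalancedAt_extend_zero_iff hf w
  have endPoint_eq : ∀ e, endPoint σ.curve e = endPoint τ.curve (f e.1, e.2) := fun e => by
    simp only [endPoint, hc]
  refine ⟨fun ⟨hpos, hbal⟩ => ⟨fun b => ?_, fun e he => ?_⟩, fun ⟨hpos, hbal⟩ =>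
    ⟨fun b => ?_, fun e he => ?_⟩⟩
  · simpa [hf.extend_apply] using hpos (f b)
  · exact (balanced_iff e).1 (hbal _ (endPoint_eq e ▸ he))
  · by_cases hb : ∃ a, f a = b
    · obtain ⟨a, rfl⟩ := hb
      simpa [hf.extend_apply] using hpos a
    · simp [Function.extend_apply' w _ b hb]
  · change IsBalancedAt _ _ e
    by_cases hb : ∃ a : σ.Branch × Bool, endPoint τ.curve (f a.1, a.2) = endPoint τ.curve e
    · obtain ⟨a, ha⟩ := hb
      rw [τ.isTrainTrack.isBalancedAt_congr _ ha, balanced_iff]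
      exact hbal a (by rwa [endPoint_eq, ha])
    · have hzero : ∀ e', endPoint τ.curve e' = endPoint τ.curve e →
          Function.extend f w 0 e'.1 = 0 := fun e' he' =>
        Function.extend_apply' _ _ _ fun ⟨a, ha⟩ => hb ⟨(a, e'.2), by rwa [ha]⟩
      exact (Finset.sum_eq_zero fun e' he' => hzero e' (Finset.mem_filter.1 he').2.1).trans
        (Finset.sum_eq_zero fun e' he' => hzero e' (Finset.mem_filter.1 he').2.1).symm

theorem boundaryWeight_extend_zero (hf : Function.Injective f)
    (hc : ∀ b, σ.curve b = τ.curve (f b)) (X : Set ℂ) (w : σ.Branch → ℝ) :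
    τ.boundaryWeight X (Function.extend f w 0) = σ.boundaryWeight X w := by
  classical
  unfold boundaryWeight
  rw [← sum_filter_extend_zero hf w fun e => endPoint τ.curve e ∈ X]
  have hσ : σ.curve = fun b => τ.curve (f b) := funext hc
  rw [hσ]
  rfl

theorem IsFull.reindex (h : σ.IsFull) (f : τ.Branch ≃ σ.Branch)
    (hf : ∀ b, τ.curve b = σ.curve (f b)) : τ.IsFull := by
  obtain ⟨w, hw, hpos⟩ := h
  have hext : Function.extend f (w ∘ f) 0 = w := funext fun b => by
    obtain ⟨a, rfl⟩ := f.surjective b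
    exact f.injective.extend_apply ..
  exact ⟨w ∘ f, (extend_zero_mem_weightCone_iff f.injective hf _).1 (by rwa [hext]),
    fun b => hpos _⟩

theorem isFullSubtrack_of_mem_iff_pos {w : τ.Branch → ℝ} (hw : w ∈ τ.weightCone)
    {A : Finset τ.Branch} (hA : ∀ b, b ∈ A ↔ 0 < w b) : τ.IsFullSubtrack A := by
  have hsub : τ.IsSubtrack A :=
    τ.isTrainTrack.comp_injective Subtype.val_injective fun (e : A × Bool) he => by
      obtain ⟨e', hopp, hpos⟩ := IsBalancedAt.exists_oppositeSide_pos hw.1 ((hA _).1 e.1.2)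
        (hw.2 (e.1, e.2) he)
      exact ⟨(⟨e'.1, (hA _).2 hpos⟩, e'.2), hopp⟩
  have hext : Function.extend Subtype.val (fun b : A => w b) 0 = w := funext fun b => by
    by_cases hb : b ∈ A
    · exact Subtype.val_injective.extend_apply _ _ (⟨b, hb⟩ : A)
    · rw [Function.extend_apply' _ _ _ (by simpa using hb)]
      exact le_antisymm (hw.1 b) (not_lt.1 ((hA b).not.1 hb))
  exact ⟨hsub, fun b : A => w b,
    (extend_zero_mem_weightCone_iff (σ := τ.sub A hsub) Subtype.val_injective (fun _ => rfl) _).1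
      (hext.symm ▸ hw :), fun b => (hA _).1 b.2⟩

end TrainTrack

/-! ### Isotopies -/

namespace TrainTrack.Isotopy

variable {σ σ' τ τ' : TrainTrack}

/-- The constant isotopy between train tracks whose branches are the same subsets of the annulus,
possibly with different parametrizations. -/
def const (e : σ.Branch ≃ τ.Branch)
    (h : ∀ b, σ.curve b '' Icc 0 1 = τ.curve (e b) '' Icc 0 1) : Isotopy σ τ where
  family _ := σ.curve
  branchEquiv := e
  isTrainTrack _ _ := σ.isTrainTrack
  continuousOn b :=
    ((σ.isTrainTrack.contDiff b).continuous.comp continuous_snd).continuousOn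
  continuousOn_deriv b :=
    (((σ.isTrainTrack.contDiff b).continuous_deriv le_rfl).comp continuous_snd).continuousOn
  incidence _ _ _ _ := Iff.rfl
  start _ _ _ := rfl
  finish := h

/-- The isotopy obtained by relabelling the branches at the start by `f` and at the end by `g`. -/
def reindex (φ : Isotopy σ τ) (f : σ'.Branch ≃ σ.Branch)
    (hf : ∀ b, σ'.curve b = σ.curve (f b)) (g : τ.Branch ≃ τ'.Branch)
    (hg : ∀ b, τ'.curve (g b) = τ.curve b) : Isotopy σ' τ' where
  family s b := φ.family s (f b)
  branchEquiv := (f.trans φ.branchEquiv).trans g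
  isTrainTrack s hs := (φ.isTrainTrack s hs).comp_equiv f
  continuousOn b := φ.continuousOn (f b)
  continuousOn_deriv b := φ.continuousOn_deriv (f b)
  incidence s hs e e' := by
    have := φ.incidence s hs (f e.1, e.2) (f e'.1, e'.2)
    simpa [endPoint, hf] using this
  start b u hu := by rw [φ.start (f b) u hu, hf]
  finish b := by simp [φ.finish (f b), hg]

theorem continuousOn_endPoint (φ : Isotopy σ τ) (e : σ.Branch × Bool) :
    ContinuousOn (fun s => endPoint (φ.family s) e) (Icc 0 1) := by
  refine (φ.continuousOn e.1).comp (f := fun s : ℝ => (s, if e.2 then (1 : ℝ) else 0))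
    (by fun_prop) fun s hs => ⟨hs, ?_⟩
  dsimp only
  split_ifs <;> simp

theorem endPoint_family_zero (φ : Isotopy σ τ) (e : σ.Branch × Bool) :
    endPoint (φ.family 0) e = endPoint σ.curve e := by
  refine φ.start e.1 _ ?_
  split_ifs <;> simp

theorem endPoint_family_mem_connectorBoundary (φ : Isotopy σ τ) {e : σ.Branch × Bool}
    (he : endPoint σ.curve e ∈ connectorBoundary) {s : ℝ} (hs : s ∈ Icc (0 : ℝ) 1) :
    endPoint (φ.family s) e ∈ connectorBoundary :=
  ((φ.isTrainTrack s hs).endPoint_mem_connectorBoundary_iff e).2 fun e' he' =>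
    σ.isTrainTrack.boundary_inj e e' he ((φ.incidence s hs e' e).1 he')

-- The two boundary circles have different radii, so an end point cannot jump between them.
theorem norm_endPoint_family_one (φ : Isotopy σ τ) {e : σ.Branch × Bool}
    (he : endPoint σ.curve e ∈ connectorBoundary) :
    ‖endPoint (φ.family 1) e‖ = ‖endPoint σ.curve e‖ := by
  have hmaps : MapsTo (fun s => ‖endPoint (φ.family s) e‖) (Icc (0 : ℝ) 1)
      {Real.exp 1, Real.exp (-1)} := fun s hs => φ.endPoint_family_mem_connectorBoundary he hs
  rw [← φ.endPoint_family_zero]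
  exact isPreconnected_Icc.constant_of_mapsTo (Set.toFinite _).isDiscrete
    (φ.continuousOn_endPoint e).norm hmaps (right_mem_Icc.2 zero_le_one)
    (left_mem_Icc.2 zero_le_one)

end TrainTrack.Isotopy

/-! ### Gluing of weight vectors on sub-train-tracks -/

section Glue

variable {ι : Type} {𝒯 : ι → TrainTrack} {i j : ι} {v : (𝒯 i).Branch → ℝ} {w : (𝒯 j).Branch → ℝ}

theorem Glue.sum_eq (h : Glue 𝒯 i j v w) : ∑ b, v b = ∑ b, w b := by
  classical
  obtain ⟨A, B, hA, hB, φ, -, -, hv, hw, hvw⟩ := h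
  let e : A ≃ B := φ.branchEquiv
  rw [← Finset.sum_subset (Finset.subset_univ A) fun b _ => hv b,
    ← Finset.sum_subset (Finset.subset_univ B) fun b _ => hw b, ← Finset.sum_coe_sort A,
    ← Finset.sum_coe_sort B, ← e.sum_comp]
  exact Finset.sum_congr rfl fun a _ => (hvw a).symm

theorem Glue.exists_eq_of_ne_zero (h : Glue 𝒯 i j v w) {b : (𝒯 i).Branch} (hb : v b ≠ 0) :
    ∃ b', w b' = v b := by
  obtain ⟨A, B, _, _, φ, -, -, hv, -, hvw⟩ := h
  exact ⟨_, hvw ⟨b, not_not.1 (mt (hv b) hb)⟩⟩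

theorem Glue.exists_eq_of_ne_zero' (h : Glue 𝒯 i j v w) {b' : (𝒯 j).Branch} (hb : w b' ≠ 0) :
    ∃ b, v b = w b' := by
  obtain ⟨A, B, _, _, φ, -, -, -, hw, hvw⟩ := h
  let e : A ≃ B := φ.branchEquiv
  have he := hvw (e.symm ⟨b', not_not.1 (mt (hw b') hb)⟩)
  exact ⟨_, (he.symm.trans (congrArg (fun x : B => w x.1) (e.apply_symm_apply _)) :)⟩

variable {κ : Type} (τ : κ → TrainTrack)

/-- The indices of the collection of all full sub-train-tracks of the train tracks `τ k`. -/
abbrev SubtrackIndex : Type := Σ k, {A : Finset (τ k).Branch // (τ k).IsFullSubtrack A}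

/-- The extension by zero of a weight vector on a sub-train-track of `τ k` to all branches of
`τ k`. -/
def ambientWeight (i : SubtrackIndex τ) :
    ((fullSubtracks τ i).Branch → ℝ) →ₗ[ℝ] ((τ i.1).Branch → ℝ) :=
  Function.ExtendByZero.linearMap ℝ (Subtype.val : i.2.1 → (τ i.1).Branch)

variable {τ}

theorem ambientWeight_coe (i : SubtrackIndex τ) (w : i.2.1 → ℝ) (b : i.2.1) :
    ambientWeight τ i w b.1 = w b :=
  Subtype.val_injective.extend_apply w _ b

theorem ambientWeight_of_notMem (i : SubtrackIndex τ) (w : i.2.1 → ℝ) {b : (τ i.1).Branch}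
    (hb : b ∉ i.2.1) : ambientWeight τ i w b = 0 :=
  Function.extend_apply' w _ b (by simpa using hb)

theorem ambientWeight_mem_weightCone_iff (i : SubtrackIndex τ)
    (w : (fullSubtracks τ i).Branch → ℝ) :
    ambientWeight τ i w ∈ (τ i.1).weightCone ↔ w ∈ (fullSubtracks τ i).weightCone :=
  TrainTrack.extend_zero_mem_weightCone_iff (f := (Subtype.val : i.2.1 → _)) Subtype.val_injective
    (fun _ => rfl) w

theorem boundaryWeight_ambientWeight (i : SubtrackIndex τ) (X : Set ℂ)
    (w : (fullSubtracks τ i).Branch → ℝ) :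
    (τ i.1).boundaryWeight X (ambientWeight τ i w) = (fullSubtracks τ i).boundaryWeight X w :=
  TrainTrack.boundaryWeight_extend_zero (f := (Subtype.val : i.2.1 → _)) Subtype.val_injective
    (fun _ => rfl) X w

theorem sum_ambientWeight (i : SubtrackIndex τ) (w : i.2.1 → ℝ) :
    ∑ b, ambientWeight τ i w b = ∑ b, w b :=
  (Fintype.sum_of_injective Subtype.val Subtype.val_injective _ _
    (fun _ hb => ambientWeight_of_notMem i w (by simpa using hb))
    fun b => (ambientWeight_coe i w b).symm).symm

/-- A subset `D` of a subset `A`, viewed as a subset `E` of the whole type. -/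
def flattenEquiv {B : Type} {A E : Finset B} {D : Finset A}
    (h : D.map (.subtype (· ∈ A)) = E) : D ≃ E where
  toFun d := ⟨d.1.1, h ▸ Finset.mem_map_of_mem (.subtype (· ∈ A)) d.2⟩
  invFun e :=
    have he : ∃ ha : e.1 ∈ A, ⟨e.1, ha⟩ ∈ D := by simpa using h.ge e.2
    ⟨⟨e.1, he.fst⟩, he.snd⟩
  left_inv _ := rfl
  right_inv _ := rfl

theorem TrainTrack.isFullSubtrack_iff_of_map_eq {τ : TrainTrack} {A E : Finset τ.Branch}
    (hA : τ.IsSubtrack A) {D : Finset A} (h : D.map (.subtype (· ∈ A)) = E) :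
    (τ.sub A hA).IsFullSubtrack D ↔ τ.IsFullSubtrack E := by
  refine ⟨fun hD => ⟨hD.1.comp_equiv (flattenEquiv h).symm, ?_⟩,
    fun hE => ⟨hE.1.comp_equiv (flattenEquiv h), ?_⟩⟩
  · exact hD.2.reindex (flattenEquiv h).symm fun _ => rfl
  · exact hE.2.reindex (flattenEquiv h) fun _ => rfl

theorem isClosedCollection_fullSubtracks : IsClosedCollection (fullSubtracks τ) := by
  refine ⟨fun i => i.2.2.2, fun i A h hfull => ?_⟩
  let A' : Finset i.2.1 := A
  exact ⟨⟨i.1, _, (TrainTrack.isFullSubtrack_iff_of_map_eq i.2.2.1 (D := A') rfl).1 ⟨h, hfull⟩⟩,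
    ⟨.const (flattenEquiv (D := A') rfl) fun _ => rfl⟩⟩

theorem ambientWeight_eq_zero_of_notMem_map (i : SubtrackIndex τ) {D : Finset i.2.1}
    {w : i.2.1 → ℝ} (hw : ∀ b, b ∉ D → w b = 0) {b : (τ i.1).Branch}
    (hb : b ∉ D.map (.subtype (· ∈ i.2.1))) : ambientWeight τ i w b = 0 := by
  by_cases hbi : b ∈ i.2.1
  · exact (ambientWeight_coe i w ⟨b, hbi⟩).trans (hw _ fun h => hb (Finset.mem_map_of_mem _ h))
  · exact ambientWeight_of_notMem i w hbi

theorem Glue.ambientWeight {i j : SubtrackIndex τ} {v : (fullSubtracks τ i).Branch → ℝ}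
    {w : (fullSubtracks τ j).Branch → ℝ} (h : Glue (fullSubtracks τ) i j v w) :
    Glue τ i.1 j.1 (ambientWeight τ i v) (ambientWeight τ j w) := by
  obtain ⟨A, B, hA, hB, φ, hAfull, hBfull, hv, hw, hvw⟩ := h
  let A' : Finset i.2.1 := A
  let B' : Finset j.2.1 := B
  have hA' := (TrainTrack.isFullSubtrack_iff_of_map_eq i.2.2.1 (D := A') rfl).1 ⟨hA, hAfull⟩
  have hB' := (TrainTrack.isFullSubtrack_iff_of_map_eq j.2.2.1 (D := B') rfl).1 ⟨hB, hBfull⟩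
  let f := flattenEquiv (D := A') rfl
  refine ⟨_, _, hA'.1, hB'.1,
    φ.reindex f.symm (fun _ => rfl) (flattenEquiv (D := B') rfl) fun _ => rfl, hA'.2, hB'.2,
    fun b hb => ambientWeight_eq_zero_of_notMem_map i hv hb,
    fun b hb => ambientWeight_eq_zero_of_notMem_map j hw hb, fun a => ?_⟩
  exact (ambientWeight_coe j w _).trans ((hvw (f.symm a)).trans (ambientWeight_coe i v _).symm)

theorem glue_of_isotopy {i j : SubtrackIndex τ} {D : Finset (τ i.1).Branch}
    {E : Finset (τ j.1).Branch} (hD : (τ i.1).IsFullSubtrack D) (hE : (τ j.1).IsFullSubtrack E)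
    (hDi : D ⊆ i.2.1) (hEj : E ⊆ j.2.1) (φ : ((τ i.1).sub D hD.1).Isotopy ((τ j.1).sub E hE.1))
    {v : (fullSubtracks τ i).Branch → ℝ} {w : (fullSubtracks τ j).Branch → ℝ}
    (hv : ∀ b, b ∉ D → ambientWeight τ i v b = 0) (hw : ∀ b, b ∉ E → ambientWeight τ j w b = 0)
    (hvw : ∀ d : D, ambientWeight τ j w (show E from φ.branchEquiv d).1 = ambientWeight τ i v d) :
    Glue (fullSubtracks τ) i j v w := by
  classical
  have hD' : (D.subtype (· ∈ i.2.1)).map (.subtype (· ∈ i.2.1)) = D :=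
    Finset.subtype_map_of_mem hDi
  have hE' : (E.subtype (· ∈ j.2.1)).map (.subtype (· ∈ j.2.1)) = E :=
    Finset.subtype_map_of_mem hEj
  have hDsub := (TrainTrack.isFullSubtrack_iff_of_map_eq i.2.2.1 hD').2 hD
  have hEsub := (TrainTrack.isFullSubtrack_iff_of_map_eq j.2.2.1 hE').2 hE
  refine ⟨_, _, hDsub.1, hEsub.1, φ.reindex (flattenEquiv hD') (fun _ => rfl)
    (flattenEquiv hE').symm fun _ => rfl, hDsub.2, hEsub.2, fun b hb => ?_, fun b hb => ?_,
    fun a => ?_⟩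
  · rw [← ambientWeight_coe i v b]
    exact hv _ fun h => hb (Finset.mem_subtype.2 h)
  · rw [← ambientWeight_coe j w b]
    exact hw _ fun h => hb (Finset.mem_subtype.2 h)
  · exact (ambientWeight_coe j w _).symm.trans
      ((hvw (flattenEquiv hD' a)).trans (ambientWeight_coe i v _))

/-- The index of the full train track `τ k` in the collection of its full sub-train-tracks. -/
def wholeIndex {k : κ} (h : (τ k).IsFull) : SubtrackIndex τ :=
  ⟨k, Finset.univ, h.choose_spec.1 |> fun hw => TrainTrack.isFullSubtrack_of_mem_iff_pos hw
    fun b => by simpa using h.choose_spec.2 b⟩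

/-- A weight vector on `τ k`, as a weight vector on the corresponding member of `fullSubtracks τ`.
-/
def wholeWeight {k : κ} (h : (τ k).IsFull) (w : (τ k).Branch → ℝ) :
    (fullSubtracks τ (wholeIndex h)).Branch → ℝ :=
  fun b : (Finset.univ : Finset (τ k).Branch) => w b

theorem ambientWeight_wholeWeight {k : κ} (h : (τ k).IsFull) (w : (τ k).Branch → ℝ) :
    ambientWeight τ (wholeIndex h) (wholeWeight h w) = w :=
  funext fun b => ambientWeight_coe (wholeIndex h) (wholeWeight h w) ⟨b, Finset.mem_univ b⟩

theorem glue_wholeWeight (i : SubtrackIndex τ) (h : (τ i.1).IsFull)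
    (w : (fullSubtracks τ i).Branch → ℝ) :
    Glue (fullSubtracks τ) i (wholeIndex h) w (wholeWeight h (ambientWeight τ i w)) := by
  refine glue_of_isotopy (j := wholeIndex h) i.2.2 i.2.2 subset_rfl (Finset.subset_univ _)
    (.const (Equiv.refl _) fun _ => rfl) (fun b => ambientWeight_of_notMem i w) (fun b hb => ?_)
    fun d => ?_
  · rw [ambientWeight_wholeWeight]
    exact ambientWeight_of_notMem i w hb
  · rw [ambientWeight_wholeWeight]
    rfl

end Glue

/-! ### Change of the logarithm along curves -/

section LogChange

open intervalIntegral

/-- The total change of a continuous logarithm along the curve `f u`, `0 ≤ u ≤ 1`, in the punctured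
plane. -/
def logChange (f : ℝ → ℂ) : ℂ := ∫ u in (0 : ℝ)..1, logDeriv f u

variable {f g : ℝ → ℂ}

theorem continuousOn_logDeriv (hf : ContDiff ℝ 1 f) (h0 : ∀ u ∈ Icc (0 : ℝ) 1, f u ≠ 0) :
    ContinuousOn (logDeriv f) (Icc 0 1) :=
  (hf.continuous_deriv le_rfl).continuousOn.div hf.continuous.continuousOn h0

theorem exp_logChange (hf : ContDiff ℝ 1 f) (h0 : ∀ u ∈ Icc (0 : ℝ) 1, f u ≠ 0) :
    Complex.exp (logChange f) = f 1 / f 0 := by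
  set q : ℝ → ℂ := IccExtend zero_le_one ((Icc (0 : ℝ) 1).domRestrict (logDeriv f))
  have hq : Continuous q := (continuousOn_logDeriv hf h0).domRestrict.Icc_extend'
  have hqu : ∀ u ∈ Icc (0 : ℝ) 1, q u = logDeriv f u := fun u hu => by
    simp [q, IccExtend_of_mem _ _ hu, Set.domRestrict_apply]
  have hderiv : ∀ u ∈ Icc (0 : ℝ) 1,
      HasDerivAt (fun u => f u * Complex.exp (-∫ x in (0 : ℝ)..u, q x)) 0 u := fun u hu => by
    have hintegral := (hq.integral_hasStrictDerivAt 0 u).hasDerivAt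
    refine (((hf.differentiable one_ne_zero) u).hasDerivAt.mul hintegral.neg.cexp).congr_deriv ?_
    rw [hqu u hu, logDeriv_apply]
    field_simp [h0 u hu]
    ring
  have hconst := constant_of_has_deriv_right_zero
    (fun u hu => (hderiv u hu).continuousAt.continuousWithinAt)
    (fun u hu => (hderiv u ⟨hu.1, hu.2.le⟩).hasDerivWithinAt) 1 (by simp)
  have hintegral : logChange f = ∫ u in (0 : ℝ)..1, q u := integral_congr fun u hu => by
    rw [uIcc_of_le zero_le_one] at hu
    exact (hqu u hu).symm
  simp only [integral_same, neg_zero, Complex.exp_zero, mul_one, Complex.exp_neg] at hconst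
  rw [hintegral, ← hconst]
  field_simp [h0 1 (by simp), Complex.exp_ne_zero]

theorem logChange_eq_log_sub_log (hf : ContDiff ℝ 1 f) {a : ℂ}
    (ha : ∀ u ∈ Icc (0 : ℝ) 1, a * f u ∈ Complex.slitPlane) :
    logChange f = Complex.log (a * f 1) - Complex.log (a * f 0) := by
  have h0 : ∀ u ∈ Icc (0 : ℝ) 1, a ≠ 0 ∧ f u ≠ 0 := fun u hu =>
    mul_ne_zero_iff.1 (Complex.slitPlane_ne_zero (ha u hu))
  refine integral_eq_sub_of_hasDerivAt (f := fun u => Complex.log (a * f u)) (fun u hu => ?_) ?_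
  · rw [uIcc_of_le zero_le_one] at hu
    refine ((((hf.differentiable one_ne_zero) u).hasDerivAt.const_mul a).clog_real
      (ha u hu)).congr_deriv ?_
    rw [mul_div_mul_left _ _ (h0 u hu).1, logDeriv_apply]
  · refine ContinuousOn.intervalIntegrable ?_
    rw [uIcc_of_le zero_le_one]
    exact continuousOn_logDeriv hf fun u hu => (h0 u hu).2

theorem logChange_halfTurn (hf : ContDiff ℝ 1 f) (h0 : ∀ u ∈ Icc (0 : ℝ) 1, f u ≠ 0) {ε δ : ℝ}
    (hε : ε = 1 ∨ ε = -1) (hδ : δ = 1 ∨ δ = -1) (him : ∀ u ∈ Icc (0 : ℝ) 1, 0 ≤ ε * δ * (f u).im)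
    (hf0 : f 0 = δ) (hf1 : f 1 = -δ) : logChange f = ε * (Real.pi * Complex.I) := by
  -- This rotation moves the half plane that contains the curve into the right half plane.
  rw [logChange_eq_log_sub_log (a := -(ε * δ) * Complex.I) hf, hf0, hf1]
  · rcases hε with rfl | rfl <;> rcases hδ with rfl | rfl <;>
      simp [Complex.log_I, Complex.log_neg_I] <;> ring
  · intro u hu
    rw [Complex.mem_slitPlane_iff]
    by_cases hre : (f u).re = 0
    · left
      have hne : ε * δ * (f u).im ≠ 0 := by
        have : (f u).im ≠ 0 := fun h => h0 u hu (Complex.ext hre h)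
        rcases hε with rfl | rfl <;> rcases hδ with rfl | rfl <;> simpa
      simpa using (him u hu).lt_of_ne' hne
    · right
      rcases hε with rfl | rfl <;> rcases hδ with rfl | rfl <;> simpa

/-- A `C¹`-continuous family, parametrized by `s ∈ [0, 1]`, of `C¹` curves in the punctured plane.
-/
structure IsPuncturedFamily (F : ℝ → ℝ → ℂ) : Prop where
  contDiff : ∀ s ∈ Icc (0 : ℝ) 1, ContDiff ℝ 1 (F s)
  continuousOn : ContinuousOn (fun p : ℝ × ℝ => F p.1 p.2) (Icc (0 : ℝ) 1 ×ˢ Icc (0 : ℝ) 1)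
  continuousOn_deriv :
    ContinuousOn (fun p : ℝ × ℝ => deriv (F p.1) p.2) (Icc (0 : ℝ) 1 ×ˢ Icc (0 : ℝ) 1)
  ne_zero : ∀ s ∈ Icc (0 : ℝ) 1, ∀ u ∈ Icc (0 : ℝ) 1, F s u ≠ 0

variable {F G : ℝ → ℝ → ℂ}

theorem IsPuncturedFamily.continuousOn_logChange (hF : IsPuncturedFamily F) :
    ContinuousOn (fun s => logChange (F s)) (Icc 0 1) := by
  let p : ℝ → ℝ := fun x => projIcc (0 : ℝ) 1 zero_le_one x
  have hp : Continuous p := continuous_subtype_val.comp continuous_projIcc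
  have hmem : ∀ x, p x ∈ Icc (0 : ℝ) 1 := fun x => (projIcc (0 : ℝ) 1 zero_le_one x).2
  have hfix : ∀ x ∈ Icc (0 : ℝ) 1, p x = x := fun x hx => by simp [p, projIcc_of_mem _ hx]
  have hcont : Continuous fun q : ℝ × ℝ => logDeriv (F (p q.1)) (p q.2) :=
    (hF.continuousOn_deriv.div hF.continuousOn fun q hq => hF.ne_zero _ hq.1 _ hq.2).comp_continuous
      (f := fun q : ℝ × ℝ => (p q.1, p q.2)) (by fun_prop) fun q => ⟨hmem _, hmem _⟩
  refine (continuous_parametric_intervalIntegral_of_continuous' (μ := MeasureTheory.volume)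
    (f := fun s u => logDeriv (F (p s)) (p u)) hcont 0 1).continuousOn.congr
    fun s hs => integral_congr fun u hu => ?_
  rw [uIcc_of_le zero_le_one] at hu
  simp only [hfix s hs, hfix u hu]

/-- The winding number around the origin of a closed curve that is composed of two arcs does not
change in a family. -/
theorem IsPuncturedFamily.logChange_add_logChange_eq (hF : IsPuncturedFamily F)
    (hG : IsPuncturedFamily G) (hFG : ∀ s ∈ Icc (0 : ℝ) 1, F s 1 = G s 0 ∧ G s 1 = F s 0) :
    (logChange (F 0) + logChange (G 0)).im = (logChange (F 1) + logChange (G 1)).im := by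
  let W : ℝ → ℂ := fun s => logChange (F s) + logChange (G s)
  have hW : ContinuousOn W (Icc 0 1) := hF.continuousOn_logChange.add hG.continuousOn_logChange
  have hexp : ∀ s ∈ Icc (0 : ℝ) 1, Complex.exp (W s) = 1 := fun s hs => by
    rw [Complex.exp_add, exp_logChange (hF.contDiff s hs) (hF.ne_zero s hs),
      exp_logChange (hG.contDiff s hs) (hG.ne_zero s hs), (hFG s hs).1, (hFG s hs).2]
    have h0 := hF.ne_zero s hs 0 (by simp)
    have h1 := hG.ne_zero s hs 0 (by simp)
    field_simp
  have hmaps : MapsTo (fun s => (W s).im / (2 * Real.pi)) (Icc 0 1) (range ((↑) : ℤ → ℝ)) :=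
    fun s hs => by
      obtain ⟨n, hn⟩ := Complex.exp_eq_one_iff.1 (hexp s hs)
      exact ⟨n, by simp [hn, Real.pi_ne_zero]⟩
  have hconst := isPreconnected_Icc.constant_of_mapsTo
    Int.isClosedEmbedding_coe_real.isEmbedding.isDiscrete_range
    ((Complex.continuous_im.comp_continuousOn hW).div_const _) hmaps
    (left_mem_Icc.2 zero_le_one) (right_mem_Icc.2 zero_le_one)
  exact (div_left_inj' (by positivity)).1 hconst

end LogChange

theorem ne_zero_of_mem_connector {z : ℂ} (hz : z ∈ connector) : z ≠ 0 :=
  norm_pos_iff.1 ((Real.exp_pos _).trans_le hz.1)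

theorem TrainTrack.Isotopy.isPuncturedFamily {σ τ : TrainTrack} (φ : Isotopy σ τ) (b : σ.Branch) :
    IsPuncturedFamily fun s => φ.family s b where
  contDiff s hs := (φ.isTrainTrack s hs).contDiff b
  continuousOn := φ.continuousOn b
  continuousOn_deriv := φ.continuousOn_deriv b
  ne_zero s hs u hu := ne_zero_of_mem_connector ((φ.isTrainTrack s hs).mem_connector b u hu)

/-! ### The sense of turning is an isotopy invariant -/

section Turning

theorem eq_outer_of_norm_eq {k : Bool} {b : ConnectorBranch} {v : ℝ}
    (h : ‖connectorCurve k b v‖ = Real.exp 1) : b = .outer := by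
  rw [norm_connectorCurve, Real.exp_eq_exp] at h
  have := sq_nonneg v
  cases b <;> simp only at h <;> first | rfl | linarith

theorem eq_inner_of_norm_eq {k : Bool} {b : ConnectorBranch} {v : ℝ}
    (h : ‖connectorCurve k b v‖ = Real.exp (-1)) : b = .inner := by
  rw [norm_connectorCurve, Real.exp_eq_exp] at h
  have := sq_nonneg v
  cases b <;> simp only at h <;> first | rfl | linarith

theorem eq_zero_of_norm_arc_eq_norm_long {k : Bool} {b : ConnectorBranch}
    (hb : b = .outer ∨ b = .inner) {u v : ℝ}
    (h : ‖connectorCurve k b u‖ = ‖connectorCurve k .long v‖) : u = 0 := by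
  rw [norm_connectorCurve, norm_connectorCurve, Real.exp_eq_exp] at h
  rcases hb with rfl | rfl <;> simpa using h

theorem logChange_add_logChange_of_mem_halfCircles {k : Bool} {f g : ℝ → ℂ} (hf : ContDiff ℝ 1 f)
    (hg : ContDiff ℝ 1 g)
    (hflong : ∀ u ∈ Icc (0 : ℝ) 1, f u ∈ connectorCurve k .long '' Icc 0 1)
    (hgshort : ∀ u ∈ Icc (0 : ℝ) 1, g u ∈ connectorCurve k .short '' Icc 0 1)
    (hf0 : f 0 = 1) (hf1 : f 1 = -1) (hg0 : g 0 = -1) (hg1 : g 1 = 1) :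
    logChange f + logChange g = turn k * (2 * Real.pi * Complex.I) := by
  rw [logChange_halfTurn hf _ (turn_cases k) (δ := 1) (.inl rfl) _ (by simp [hf0]) (by simp [hf1]),
    logChange_halfTurn hg _ (turn_cases k) (δ := -1) (.inr rfl) _ (by simp [hg0]) (by simp [hg1])]
  · ring
  · intro u hu
    obtain ⟨v, -, hv⟩ := hgshort u hu
    exact hv ▸ polar_ne_zero _ _
  · intro u hu
    obtain ⟨v, hv, hvu⟩ := hgshort u hu
    have := sin_pi_mul_nonneg hv
    rw [← hvu, im_short]
    rcases turn_cases k with hk | hk <;> simpa [hk]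
  · intro u hu
    obtain ⟨v, -, hv⟩ := hflong u hu
    exact hv ▸ polar_ne_zero _ _
  · intro u hu
    obtain ⟨v, hv, hvu⟩ := hflong u hu
    have := sin_pi_mul_nonneg hv
    rw [← hvu, im_long]
    rcases turn_cases k with hk | hk <;> simpa [hk]

variable {k k' : Bool} (φ : (connectorTrack k).Isotopy (connectorTrack k'))

include φ

theorem family_one_mem_image {b b' : ConnectorBranch} (hb : φ.branchEquiv b = b') {u : ℝ}
    (hu : u ∈ Icc (0 : ℝ) 1) : φ.family 1 b u ∈ connectorCurve k' b' '' Icc 0 1 := by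
  subst hb
  exact φ.finish b ▸ mem_image_of_mem _ hu

theorem branchEquiv_outer : φ.branchEquiv .outer = .outer := by
  obtain ⟨v, -, hv⟩ := family_one_mem_image φ (b := .outer) rfl (right_mem_Icc.2 zero_le_one)
  have hnorm : ‖endPoint (connectorCurve k) (.outer, true)‖ = Real.exp 1 := by
    simp [endPoint, norm_connectorCurve]
  exact eq_outer_of_norm_eq ((congrArg norm hv).trans
    ((φ.norm_endPoint_family_one (e := (.outer, true)) (.inl hnorm)).trans hnorm))

theorem branchEquiv_inner : φ.branchEquiv .inner = .inner := by
  obtain ⟨v, -, hv⟩ := family_one_mem_image φ (b := .inner) rfl (right_mem_Icc.2 zero_le_one)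
  have hnorm : ‖endPoint (connectorCurve k) (.inner, true)‖ = Real.exp (-1) := by
    simp [endPoint, norm_connectorCurve]
  exact eq_inner_of_norm_eq ((congrArg norm hv).trans
    ((φ.norm_endPoint_family_one (e := (.inner, true)) (.inr hnorm)).trans hnorm))

theorem branchEquiv_short (hlong : φ.branchEquiv .long = .long) :
    φ.branchEquiv .short = .short := by
  have ne : ∀ b : ConnectorBranch, φ.branchEquiv b = b → b ≠ .short → φ.branchEquiv .short ≠ b :=
    fun b hb hne h => hne (φ.branchEquiv.injective (hb.trans h.symm))
  cases h : φ.branchEquiv .short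
  case short => rfl
  case outer => exact absurd h (ne .outer (branchEquiv_outer φ) nofun)
  case inner => exact absurd h (ne .inner (branchEquiv_inner φ) nofun)
  case long => exact absurd h (ne .long hlong nofun)

theorem family_one_arc_zero (hlong : φ.branchEquiv .long = .long) {b : ConnectorBranch}
    (hb : b = .outer ∨ b = .inner) (hfix : φ.branchEquiv b = b) {u : ℝ} (hu : u ∈ Icc (0 : ℝ) 1)
    (h : φ.family 1 .long u = φ.family 1 b 0) :
    φ.family 1 .long u = connectorCurve k' b 0 := by
  obtain ⟨v, -, hv⟩ := family_one_mem_image φ hlong hu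
  obtain ⟨v', -, hv'⟩ := family_one_mem_image φ hfix (left_mem_Icc.2 zero_le_one)
  have hzero := eq_zero_of_norm_arc_eq_norm_long hb
    (congrArg norm ((hv'.trans h.symm).trans hv.symm))
  rw [h, ← hv', hzero]

theorem family_one_long_zero (hlong : φ.branchEquiv .long = .long) :
    φ.family 1 .long 0 = 1 :=
  (family_one_arc_zero φ hlong (.inl rfl) (branchEquiv_outer φ) (by simp)
    ((φ.incidence 1 (by simp) (.long, false) (.outer, false)).2
      ((long_zero k).trans (outer_zero k).symm))).trans (outer_zero k')

theorem family_one_long_one (hlong : φ.branchEquiv .long = .long) :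
    φ.family 1 .long 1 = -1 :=
  (family_one_arc_zero φ hlong (.inr rfl) (branchEquiv_inner φ) (by simp)
    ((φ.incidence 1 (by simp) (.long, true) (.inner, false)).2
      ((long_one k).trans (inner_zero k).symm))).trans (inner_zero k')

theorem family_core_closed {s : ℝ} (hs : s ∈ Icc (0 : ℝ) 1) :
    φ.family s .long 1 = φ.family s .short 0 ∧ φ.family s .short 1 = φ.family s .long 0 :=
  ⟨(φ.incidence s hs (.long, true) (.short, false)).2 ((long_one k).trans (short_zero k).symm),
    (φ.incidence s hs (.short, true) (.long, false)).2 ((short_one k).trans (long_zero k).symm)⟩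

-- The core circle, run through along the half circles `long` and `short`, has winding number
-- `turn k`.
theorem turn_eq_of_isotopy (hlong : φ.branchEquiv .long = .long) : k = k' := by
  have hstart : ∀ b, ∀ u ∈ Icc (0 : ℝ) 1, φ.family 0 b u = connectorCurve k b u := φ.start
  have hwinding := (φ.isPuncturedFamily .long).logChange_add_logChange_eq
    (φ.isPuncturedFamily .short) fun s hs => family_core_closed φ hs
  have hcore := family_core_closed φ (right_mem_Icc.2 zero_le_one)
  have hshort := branchEquiv_short φ hlong
  rw [logChange_add_logChange_of_mem_halfCircles (k := k)
      ((φ.isPuncturedFamily .long).contDiff 0 (by simp))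
      ((φ.isPuncturedFamily .short).contDiff 0 (by simp))
      (fun u hu => ⟨u, hu, (hstart _ u hu).symm⟩) (fun u hu => ⟨u, hu, (hstart _ u hu).symm⟩)
      ((hstart _ 0 (by simp)).trans (long_zero k)) ((hstart _ 1 (by simp)).trans (long_one k))
      ((hstart _ 0 (by simp)).trans (short_zero k)) ((hstart _ 1 (by simp)).trans (short_one k)),
    logChange_add_logChange_of_mem_halfCircles (k := k')
      ((φ.isPuncturedFamily .long).contDiff 1 (by simp))
      ((φ.isPuncturedFamily .short).contDiff 1 (by simp))
      (fun u hu => family_one_mem_image φ hlong hu)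
      (fun u hu => family_one_mem_image φ hshort hu)
      (family_one_long_zero φ hlong) (family_one_long_one φ hlong)
      (hcore.1.symm.trans (family_one_long_one φ hlong))
      (hcore.2.trans (family_one_long_zero φ hlong))] at hwinding
  have hturn : turn k = turn k' := by simpa [Real.pi_ne_zero] using hwinding
  revert hturn
  cases k <;> cases k' <;> simp [turn] <;> norm_num

end Turning

/-! ### Weights on the standard tracks -/

section Weights

theorem sum_connectorBranch {M : Type*} [AddCommMonoid M] (f : ConnectorBranch → M) :
    ∑ b, f b = f .outer + f .inner + f .long + f .short := by
  have huniv : (Finset.univ : Finset ConnectorBranch) = {.outer, .inner, .long, .short} := rfl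
  simp [huniv, add_assoc]

variable (k : Bool)

theorem endPoint_mem_outerBoundary_iff (e : ConnectorBranch × Bool) :
    endPoint (connectorCurve k) e ∈ outerBoundary ↔ e = (.outer, true) := by
  rcases e with ⟨b, _ | _⟩ <;> cases b <;>
    simp [endPoint, outerBoundary, norm_connectorCurve, eq_comm (a := (1 : ℝ))]; norm_num

theorem endPoint_mem_innerBoundary_iff (e : ConnectorBranch × Bool) :
    endPoint (connectorCurve k) e ∈ innerBoundary ↔ e = (.inner, true) := by
  rcases e with ⟨b, _ | _⟩ <;> cases b <;>
    simp [endPoint, innerBoundary, norm_connectorCurve, eq_comm (a := (1 : ℝ))]; norm_num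

theorem boundaryWeight_outerBoundary (W : ConnectorBranch → ℝ) :
    (connectorTrack k).boundaryWeight outerBoundary W = W .outer := by
  classical
  have hsum : ∑ e : ConnectorBranch × Bool with endPoint (connectorCurve k) e ∈ outerBoundary,
      W e.1 = W .outer := by
    simp [endPoint_mem_outerBoundary_iff, Finset.filter_eq']
  exact hsum

theorem boundaryWeight_innerBoundary (W : ConnectorBranch → ℝ) :
    (connectorTrack k).boundaryWeight innerBoundary W = W .inner := by
  classical
  have hsum : ∑ e : ConnectorBranch × Bool with endPoint (connectorCurve k) e ∈ innerBoundary,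
      W e.1 = W .inner := by
    simp [endPoint_mem_innerBoundary_iff, Finset.filter_eq']
  exact hsum

theorem endPoint_eq_one_iff (e : ConnectorBranch × Bool) :
    endPoint (connectorCurve k) e = 1 ↔
      e = (.outer, false) ∨ e = (.long, false) ∨ e = (.short, true) := by
  by_cases he : endPoint (connectorCurve k) e ∈ connectorBoundary
  · refine iff_of_false (fun h => ?_) ?_
    · simp [h, connectorBoundary, outerBoundary, innerBoundary, eq_comm (a := (1 : ℝ))] at he
    · rcases (mem_boundary_iff k e).1 he with rfl | rfl <;> simp
  · rw [mem_boundary_iff] at he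
    rcases e with ⟨b, _ | _⟩ <;> cases b <;>
      simp [endPoint, outer_zero, inner_zero, long_zero, long_one, short_zero, short_one,
        neg_eq_iff_add_eq_zero] at he ⊢

theorem endPoint_eq_neg_one_iff (e : ConnectorBranch × Bool) :
    endPoint (connectorCurve k) e = -1 ↔
      e = (.inner, false) ∨ e = (.long, true) ∨ e = (.short, false) := by
  by_cases he : endPoint (connectorCurve k) e ∈ connectorBoundary
  · refine iff_of_false (fun h => ?_) ?_
    · simp [h, connectorBoundary, outerBoundary, innerBoundary, eq_comm (a := (1 : ℝ))] at he
    · rcases (mem_boundary_iff k e).1 he with rfl | rfl <;> simp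
  · rw [mem_boundary_iff] at he
    rcases e with ⟨b, _ | _⟩ <;> cases b <;>
      simp [endPoint, outer_zero, inner_zero, long_zero, long_one, short_zero, short_one,
        eq_neg_iff_add_eq_zero] at he ⊢

variable {k} {e e' : ConnectorBranch × Bool}

theorem sides_of_endPoint_eq (he : endPoint (connectorCurve k) e ∉ connectorBoundary)
    (h : endPoint (connectorCurve k) e' = endPoint (connectorCurve k) e) :
    (SameSide (connectorCurve k) e e' ↔ 0 < endSpeed e * endSpeed e') ∧
      (OppositeSide (connectorCurve k) e e' ↔ endSpeed e * endSpeed e' < 0) := by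
  have hexcl := (connectorCurve_isTrainTrack k).not_sameSide_and_oppositeSide e e'
  have he' : endPoint (connectorCurve k) e' ∉ connectorBoundary := h ▸ he
  rcases lt_or_gt_of_ne (mul_ne_zero (endSpeed_ne_zero e) (endSpeed_ne_zero e')) with h0 | h0
  · have hopp : OppositeSide (connectorCurve k) e e' := ⟨h, sameRay_neg_endDir k e e' he he' h0⟩
    exact ⟨iff_of_false (fun hs => hexcl ⟨hs, hopp⟩) h0.not_gt, iff_of_true hopp h0⟩
  · have hsame : SameSide (connectorCurve k) e e' := ⟨h, sameRay_endDir k e e' he he' h0⟩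
    exact ⟨iff_of_true hsame h0, iff_of_false (fun ho => hexcl ⟨hsame, ho⟩) h0.not_gt⟩

theorem sameSide_iff (he : endPoint (connectorCurve k) e ∉ connectorBoundary) :
    SameSide (connectorCurve k) e e' ↔
      endPoint (connectorCurve k) e' = endPoint (connectorCurve k) e ∧
        0 < endSpeed e * endSpeed e' :=
  (and_iff_right_of_imp And.left).symm.trans
    (and_congr_right fun h => (sides_of_endPoint_eq he h).1)

theorem oppositeSide_iff (he : endPoint (connectorCurve k) e ∉ connectorBoundary) :
    OppositeSide (connectorCurve k) e e' ↔
      endPoint (connectorCurve k) e' = endPoint (connectorCurve k) e ∧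
        endSpeed e * endSpeed e' < 0 :=
  (and_iff_right_of_imp And.left).symm.trans
    (and_congr_right fun h => (sides_of_endPoint_eq he h).2)

variable {W : ConnectorBranch → ℝ}

theorem isBalancedAt_long_false_iff :
    IsBalancedAt (connectorCurve k) W (.long, false) ↔ W .long = W .short + W .outer := by
  simp [IsBalancedAt, sameSide_iff (k := k) (e := (.long, false)) (by simp [mem_boundary_iff]),
    oppositeSide_iff (k := k) (e := (.long, false)) (by simp [mem_boundary_iff]),
    (endPoint_eq_one_iff k (.long, false)).2, endPoint_eq_one_iff, Finset.sum_filter,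
    Fintype.sum_prod_type, sum_connectorBranch, endSpeed, Real.pi_pos, Real.pi_pos.not_gt, add_comm,
    (zero_lt_one' ℝ).not_gt, (mul_self_nonneg Real.pi).not_gt]

theorem isBalancedAt_long_true_iff :
    IsBalancedAt (connectorCurve k) W (.long, true) ↔ W .long = W .short + W .inner := by
  simp [IsBalancedAt, sameSide_iff (k := k) (e := (.long, true)) (by simp [mem_boundary_iff]),
    oppositeSide_iff (k := k) (e := (.long, true)) (by simp [mem_boundary_iff]),
    (endPoint_eq_neg_one_iff k (.long, true)).2, endPoint_eq_neg_one_iff, Finset.sum_filter,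
    Fintype.sum_prod_type, sum_connectorBranch, endSpeed, Real.pi_pos, Real.pi_pos.not_gt, add_comm,
    (zero_lt_one' ℝ).not_gt, (mul_self_nonneg Real.pi).not_gt]

theorem endPoint_eq_endPoint_long (he : endPoint (connectorCurve k) e ∉ connectorBoundary) :
    ∃ β, endPoint (connectorCurve k) (.long, β) = endPoint (connectorCurve k) e := by
  rw [mem_boundary_iff] at he
  rcases e with ⟨b, _ | _⟩ <;> cases b <;>
    simp [endPoint, outer_zero, inner_zero, long_zero, long_one, short_zero, short_one] at he ⊢

theorem mem_weightCone_connectorTrack_iff :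
    W ∈ (connectorTrack k).weightCone ↔
      (0 ≤ W .short ∧ 0 ≤ W .outer) ∧ W = connectorWeight (W .short) (W .outer) := by
  have hcone : W ∈ (connectorTrack k).weightCone ↔ (∀ b, 0 ≤ W b) ∧
      ∀ e, endPoint (connectorCurve k) e ∉ connectorBoundary →
        IsBalancedAt (connectorCurve k) W e := Iff.rfl
  rw [hcone]
  constructor
  · rintro ⟨hnonneg, hbal⟩
    have h1 := isBalancedAt_long_false_iff.1 (hbal (.long, false) (by simp [mem_boundary_iff]))
    have h2 := isBalancedAt_long_true_iff.1 (hbal (.long, true) (by simp [mem_boundary_iff]))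
    refine ⟨⟨hnonneg _, hnonneg _⟩, funext fun b => ?_⟩
    cases b <;> simp only [connectorWeight] <;> linarith
  · rintro ⟨⟨ht, hy⟩, hW⟩
    refine ⟨fun b => ?_, fun e he => ?_⟩
    · rw [hW]
      cases b <;> simp only [connectorWeight] <;> positivity
    · obtain ⟨β, hβ⟩ := endPoint_eq_endPoint_long he
      rw [(connectorCurve_isTrainTrack k).isBalancedAt_congr W hβ, hW]
      cases β
      exacts [isBalancedAt_long_false_iff.2 rfl, isBalancedAt_long_true_iff.2 rfl]

theorem connectorWeight_mem_weightCone {t y : ℝ} (ht : 0 ≤ t) (hy : 0 ≤ y) :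
    connectorWeight t y ∈ (connectorTrack k).weightCone :=
  mem_weightCone_connectorTrack_iff.2 ⟨⟨ht, hy⟩, rfl⟩

variable (k)

theorem bijOn_connectorWeight :
    BijOn (fun p : ℝ × ℝ => connectorWeight p.1 p.2)
      {p : ℝ × ℝ | 0 ≤ p.1 ∧ 0 ≤ p.2} (connectorTrack k).weightCone := by
  refine ⟨fun p hp => connectorWeight_mem_weightCone hp.1 hp.2,
    fun p _ q _ h => Prod.ext (congrFun h .short) (congrFun h .outer), fun W hW => ?_⟩
  obtain ⟨hnonneg, hW⟩ := mem_weightCone_connectorTrack_iff.1 hW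
  exact ⟨(W .short, W .outer), hnonneg, hW.symm⟩

/-- The two half circles of the core circle. -/
def coreBranches : Finset ConnectorBranch := {.long, .short}

/-- The branches of the arc that crosses the annulus. -/
def arcBranches : Finset ConnectorBranch := {.outer, .inner, .long}

theorem isFullSubtrack_coreBranches : (connectorTrack k).IsFullSubtrack coreBranches :=
  TrainTrack.isFullSubtrack_of_mem_iff_pos
    (connectorWeight_mem_weightCone zero_le_one le_rfl) fun b : ConnectorBranch => by
      change b ∈ coreBranches ↔ _
      cases b <;> simp [connectorWeight, coreBranches]

theorem isFullSubtrack_arcBranches : (connectorTrack k).IsFullSubtrack arcBranches :=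
  TrainTrack.isFullSubtrack_of_mem_iff_pos
    (connectorWeight_mem_weightCone le_rfl zero_le_one) fun b : ConnectorBranch => by
      change b ∈ arcBranches ↔ _
      cases b <;> simp [connectorWeight, arcBranches]

theorem isFull_connectorTrack : (connectorTrack k).IsFull :=
  ⟨connectorWeight 1 1, connectorWeight_mem_weightCone zero_le_one zero_le_one, fun b => by
    cases b <;> norm_num [connectorWeight]⟩

end Weights

/-! ### The common core circle -/

section Core

theorem glue_wholeWeight_of_isotopy {κ : Type} {τ : κ → TrainTrack} {k l : κ} (hk : (τ k).IsFull)
    (hl : (τ l).IsFull) {D : Finset (τ k).Branch} {E : Finset (τ l).Branch}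
    (hD : (τ k).IsFullSubtrack D) (hE : (τ l).IsFullSubtrack E)
    (φ : ((τ k).sub D hD.1).Isotopy ((τ l).sub E hE.1))
    {V : (τ k).Branch → ℝ} {W : (τ l).Branch → ℝ} (hV : ∀ b, b ∉ D → V b = 0)
    (hW : ∀ b, b ∉ E → W b = 0) (hVW : ∀ d : D, W (show E from φ.branchEquiv d).1 = V d) :
    Glue (fullSubtracks τ) (wholeIndex hk) (wholeIndex hl) (wholeWeight hk V)
      (wholeWeight hl W) := by
  refine glue_of_isotopy (i := wholeIndex hk) (j := wholeIndex hl) hD hE (Finset.subset_univ _)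
    (Finset.subset_univ _) φ ?_ ?_ ?_ <;> simpa only [ambientWeight_wholeWeight]

theorem connectorCurve_long_eq_short (k : Bool) (u : ℝ) :
    connectorCurve k .long u = connectorCurve (!k) .short (1 - u) := by
  apply Complex.ext
  · rw [re_long, re_short, mul_sub, mul_one, Real.cos_pi_sub, neg_neg]
  · rw [im_long, im_short, mul_sub, mul_one, Real.sin_pi_sub]
    cases k <;> simp [turn]

theorem image_connectorCurve_long (k : Bool) :
    connectorCurve k .long '' Icc 0 1 = connectorCurve (!k) .short '' Icc 0 1 := by
  have hIcc : (fun u : ℝ => 1 - u) '' Icc 0 1 = Icc 0 1 := by simp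
  rw [funext (connectorCurve_long_eq_short k), ← hIcc, image_image, hIcc]
  simp only [sub_sub_cancel]

/-- The core circles of the two standard tracks coincide, with the two half circles exchanged. -/
def coreIsotopy :
    ((connectorTrack false).sub coreBranches (isFullSubtrack_coreBranches false).1).Isotopy
      ((connectorTrack true).sub coreBranches (isFullSubtrack_coreBranches true).1) :=
  let e : coreBranches ≃ coreBranches :=
    Equiv.swap ⟨.long, by simp [coreBranches]⟩ ⟨.short, by simp [coreBranches]⟩
  .const e <| by
    rintro (b : coreBranches)
    obtain ⟨b, hb⟩ := b
    change connectorCurve false b '' _ = connectorCurve true (e ⟨b, hb⟩).1 '' _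
    cases b
    case outer => simp [coreBranches] at hb
    case inner => simp [coreBranches] at hb
    case long => simpa [e] using image_connectorCurve_long false
    case short => simpa [e] using (image_connectorCurve_long true).symm

theorem connectorWeight_zero_of_mem_coreBranches {t : ℝ} {b : ConnectorBranch}
    (hb : b ∈ coreBranches) : connectorWeight t 0 b = t := by
  cases b <;> simp [coreBranches, connectorWeight] at hb ⊢

theorem connectorWeight_zero_of_notMem_coreBranches {t : ℝ} {b : ConnectorBranch}
    (hb : b ∉ coreBranches) : connectorWeight t 0 b = 0 := by
  cases b <;> simp [coreBranches, connectorWeight] at hb ⊢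

theorem glue_core (t : ℝ) :
    Glue connectorCollection (wholeIndex (isFull_connectorTrack false))
      (wholeIndex (isFull_connectorTrack true))
      (wholeWeight (isFull_connectorTrack false) (connectorWeight t 0))
      (wholeWeight (isFull_connectorTrack true) (connectorWeight t 0)) :=
  glue_wholeWeight_of_isotopy _ _ (isFullSubtrack_coreBranches _) (isFullSubtrack_coreBranches _)
    coreIsotopy
    (fun _ => connectorWeight_zero_of_notMem_coreBranches)
    (fun _ => connectorWeight_zero_of_notMem_coreBranches) fun d =>
    (connectorWeight_zero_of_mem_coreBranches (coreIsotopy.branchEquiv d : coreBranches).2).trans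
      (connectorWeight_zero_of_mem_coreBranches d.2).symm

end Core

/-! ### Arcs across the annulus -/

section CrossingArc

theorem forall_mem_arcBranches {p : ConnectorBranch → Prop} :
    (∀ b ∈ arcBranches, p b) ↔ p .outer ∧ p .inner ∧ p .long := by
  simp [arcBranches]

theorem forall_arcEnds {p : ConnectorBranch × Bool → Prop} :
    (∀ e : ConnectorBranch × Bool, e.1 ∈ arcBranches → p e) ↔
      (p (.outer, false) ∧ p (.outer, true)) ∧ (p (.inner, false) ∧ p (.inner, true)) ∧
        (p (.long, false) ∧ p (.long, true)) := by
  rw [← forall_mem_arcBranches (p := fun b => p (b, false) ∧ p (b, true))]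
  simp only [Prod.forall, Bool.forall_bool, imp_and]

/-- The velocity with which the branches traverse the arc that crosses the annulus, when its
points are labelled by the angle by which they are turned away from the switch `1`. -/
def arcSpeed : ConnectorBranch → ℝ
  | .outer => -1
  | .inner => 1
  | .long => Real.pi
  | .short => Real.pi

/-- The angle by which the point with parameter `u` on a branch is turned away from the switch `1`.
The arc that crosses the annulus is traversed from the angle `-1` on the outer boundary to the
angle `π + 1` on the inner boundary, with switches at `0` and `π`. -/
def arcAngle (b : ConnectorBranch) (u : ℝ) : ℝ :=
  (match b with
    | .outer => 0 | .inner => Real.pi | .long => 0 | .short => Real.pi) + arcSpeed b * u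

/-- The angle at an end of a branch. -/
def endAngle (e : ConnectorBranch × Bool) : ℝ := arcAngle e.1 (if e.2 then 1 else 0)

/-- The velocity of the angle at an end of a branch, in the direction into the branch. -/
def endAngularSpeed (e : ConnectorBranch × Bool) : ℝ := if e.2 then -arcSpeed e.1 else arcSpeed e.1

theorem arcSpeed_ne_zero (b : ConnectorBranch) : arcSpeed b ≠ 0 := by
  cases b <;> simp [arcSpeed, Real.pi_ne_zero]

theorem endAngularSpeed_ne_zero (e : ConnectorBranch × Bool) : endAngularSpeed e ≠ 0 := by
  rcases e with ⟨b, _ | _⟩ <;> simp [endAngularSpeed, arcSpeed_ne_zero]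

theorem hasDerivAt_arcAngle (b : ConnectorBranch) (u : ℝ) :
    HasDerivAt (arcAngle b) (arcSpeed b) u :=
  (((hasDerivAt_id u).const_mul (arcSpeed b)).const_add _).congr_deriv (mul_one _)

variable {b b' : ConnectorBranch} {e e' : ConnectorBranch × Bool} {u v : ℝ}

theorem arcAngle_mem_Icc (hb : b ∈ arcBranches) (hu : u ∈ Icc (0 : ℝ) 1) :
    arcAngle b u ∈ Icc (-1) (Real.pi + 1) := by
  have hπ := Real.pi_pos
  obtain ⟨h0, h1⟩ := hu
  revert b
  rw [forall_mem_arcBranches]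
  simp only [arcAngle, arcSpeed]
  refine ⟨⟨?_, ?_⟩, ⟨?_, ?_⟩, ?_, ?_⟩ <;> nlinarith

theorem arcAngle_mem_Ioo (hb : b ∈ arcBranches) (hu : u ∈ Ioo (0 : ℝ) 1) :
    arcAngle b u ∈ Ioo (-1) (Real.pi + 1) := by
  have hπ := Real.pi_pos
  obtain ⟨h0, h1⟩ := hu
  revert b
  rw [forall_mem_arcBranches]
  simp only [arcAngle, arcSpeed]
  refine ⟨⟨?_, ?_⟩, ⟨?_, ?_⟩, ?_, ?_⟩ <;> nlinarith

theorem arcAngle_injective (hb : b ∈ arcBranches) (hb' : b' ∈ arcBranches)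
    (hu : u ∈ Ioo (0 : ℝ) 1) (hv : v ∈ Icc (0 : ℝ) 1) (h : arcAngle b u = arcAngle b' v) :
    b = b' ∧ u = v := by
  have hπ := Real.pi_pos
  have hπu := mul_pos hπ hu.1
  have hπu' := mul_pos hπ (sub_pos.2 hu.2)
  have hπv := mul_nonneg hπ.le hv.1
  have hπv' := mul_nonneg hπ.le (sub_nonneg.2 hv.2)
  cases b <;> cases b' <;> simp only [arcAngle, arcSpeed] at h <;>
    first
    | exact absurd hb (by decide)
    | exact absurd hb' (by decide)
    | (exfalso; linarith [hu.1, hu.2, hv.1, hv.2])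
    | exact ⟨rfl, by linarith⟩
    | exact ⟨rfl, mul_left_cancel₀ hπ.ne' (by linarith)⟩

theorem endAngle_mem_Icc (e : arcBranches × Bool) :
    endAngle (e.1, e.2) ∈ Icc (-1) (Real.pi + 1) :=
  arcAngle_mem_Icc e.1.2 (by split_ifs <;> simp)

theorem eq_of_endAngle_eq (he : e.1 ∈ arcBranches) (he' : e'.1 ∈ arcBranches)
    (hend : endAngle e = -1 ∨ endAngle e = Real.pi + 1) (h : endAngle e' = endAngle e) :
    e' = e := by
  have hπ := Real.pi_pos
  revert e e'
  simp only [Prod.forall]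
  rintro (_ | _ | _ | _) (_ | _) (_ | _ | _ | _) (_ | _) he he' hend h <;>
    simp [endAngle, arcAngle, arcSpeed, arcBranches] at he he' hend h ⊢ <;>
    linarith

theorem exists_endAngle_eq (he : e.1 ∈ arcBranches)
    (hend : ¬(endAngle e = -1 ∨ endAngle e = Real.pi + 1)) :
    ∃ e', e'.1 ∈ arcBranches ∧ endAngle e' = endAngle e ∧
      endAngularSpeed e * endAngularSpeed e' < 0 := by
  revert e
  rw [forall_arcEnds]
  have hπ := Real.pi_pos
  refine ⟨⟨fun _ => ⟨(.long, false), ?_⟩, fun h => ?_⟩,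
    ⟨fun _ => ⟨(.long, true), ?_⟩, fun h => ?_⟩,
    fun _ => ⟨(.outer, false), ?_⟩, fun _ => ⟨(.inner, false), ?_⟩⟩ <;>
  simp_all [endAngle, endAngularSpeed, arcAngle, arcSpeed, arcBranches]

end CrossingArc

/-- A regular `C¹` arc across the annulus, defined for angles between `-1` and `π + 1`. -/
structure IsCrossingArc (γ : ℝ → ℂ) : Prop where
  contDiff : ContDiff ℝ 1 γ
  immersed : ∀ θ ∈ Icc (-1) (Real.pi + 1), deriv γ θ ≠ 0
  mem_connector : ∀ θ ∈ Icc (-1) (Real.pi + 1), γ θ ∈ connector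
  injOn : InjOn γ (Icc (-1) (Real.pi + 1))
  mem_boundary_iff : ∀ θ ∈ Icc (-1) (Real.pi + 1),
    γ θ ∈ connectorBoundary ↔ θ = -1 ∨ θ = Real.pi + 1
  transverse : ∀ θ ∈ Icc (-1) (Real.pi + 1), γ θ ∈ connectorBoundary → inner ℝ (γ θ) (deriv γ θ) ≠ 0

section ArcCurve

/-- The branches into which the switches at the angles `0` and `π` divide an arc. -/
def arcCurve (γ : ℝ → ℂ) (b : arcBranches) (u : ℝ) : ℂ := γ (arcAngle b u)

variable {γ : ℝ → ℂ} {e e' : arcBranches × Bool}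

namespace IsCrossingArc

theorem deriv_arcCurve (hγ : IsCrossingArc γ) (b : arcBranches) (u : ℝ) :
    deriv (arcCurve γ b) u = arcSpeed b • deriv γ (arcAngle b u) :=
  (((hγ.contDiff.differentiable one_ne_zero _).hasDerivAt.scomp u
    (hasDerivAt_arcAngle b u))).deriv

theorem endDir_arcCurve (hγ : IsCrossingArc γ) (e : arcBranches × Bool) :
    endDir (arcCurve γ) e = endAngularSpeed (e.1, e.2) • deriv γ (endAngle (e.1, e.2)) := by
  rcases e with ⟨b, _ | _⟩ <;> simp [endDir, endAngularSpeed, endAngle, hγ.deriv_arcCurve]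

theorem endPoint_eq_iff (hγ : IsCrossingArc γ) :
    endPoint (arcCurve γ) e = endPoint (arcCurve γ) e' ↔
      endAngle (e.1, e.2) = endAngle (e'.1, e'.2) :=
  hγ.injOn.eq_iff (endAngle_mem_Icc e) (endAngle_mem_Icc e')

theorem endPoint_mem_boundary_iff (hγ : IsCrossingArc γ) :
    endPoint (arcCurve γ) e ∈ connectorBoundary ↔
      endAngle (e.1, e.2) = -1 ∨ endAngle (e.1, e.2) = Real.pi + 1 :=
  hγ.mem_boundary_iff _ (endAngle_mem_Icc e)

theorem oppositeSide (hγ : IsCrossingArc γ)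
    (h : endAngle (e'.1, e'.2) = endAngle (e.1, e.2))
    (hspeed : endAngularSpeed (e.1, e.2) * endAngularSpeed (e'.1, e'.2) < 0) :
    OppositeSide (arcCurve γ) e e' := by
  refine ⟨hγ.endPoint_eq_iff.2 h, ?_⟩
  rw [hγ.endDir_arcCurve, hγ.endDir_arcCurve, h, ← neg_smul]
  exact sameRay_smul_smul_of_mul_nonneg (by linarith)

theorem sameSide_or_oppositeSide (hγ : IsCrossingArc γ)
    (h : endPoint (arcCurve γ) e' = endPoint (arcCurve γ) e) :
    SameSide (arcCurve γ) e e' ∨ OppositeSide (arcCurve γ) e e' := by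
  have hangle := hγ.endPoint_eq_iff.1 h
  rcases lt_or_ge (endAngularSpeed (e.1, e.2) * endAngularSpeed (e'.1, e'.2)) 0 with hlt | hge
  · exact .inr (hγ.oppositeSide hangle hlt)
  · refine .inl ⟨h, ?_⟩
    rw [hγ.endDir_arcCurve, hγ.endDir_arcCurve, hangle]
    exact sameRay_smul_smul_of_mul_nonneg hge

theorem isTrainTrack (hγ : IsCrossingArc γ) : IsTrainTrack (arcCurve γ) where
  contDiff b := hγ.contDiff.comp <| contDiff_const.add (contDiff_const.mul contDiff_id)
  immersed b u hu := by
    rw [hγ.deriv_arcCurve]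
    exact smul_ne_zero (arcSpeed_ne_zero b) (hγ.immersed _ (arcAngle_mem_Icc b.2 hu))
  mem_connector b u hu := hγ.mem_connector _ (arcAngle_mem_Icc b.2 hu)
  interior b u hu hmem := by
    have hangle := arcAngle_mem_Ioo b.2 hu
    rcases (hγ.mem_boundary_iff _ (Ioo_subset_Icc_self hangle)).1 hmem with h | h
    exacts [hangle.1.ne' h, hangle.2.ne h]
  embedded b b' u hu v hv h := by
    have hangle := hγ.injOn (arcAngle_mem_Icc b.2 (Ioo_subset_Icc_self hu))
      (arcAngle_mem_Icc b'.2 hv) h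
    exact (arcAngle_injective b.2 b'.2 hu hv hangle).imp_left Subtype.ext
  transverse e he := by
    rw [hγ.endDir_arcCurve, inner_smul_right]
    exact mul_ne_zero (endAngularSpeed_ne_zero _)
      (hγ.transverse _ (endAngle_mem_Icc e) he)
  boundary_inj e e' he h := by
    obtain ⟨hb, hend⟩ := Prod.ext_iff.1 <| eq_of_endAngle_eq e.1.2 e'.1.2
      (hγ.endPoint_mem_boundary_iff.1 he) (hγ.endPoint_eq_iff.1 h)
    exact Prod.ext (Subtype.ext hb) hend
  tangent e e' h := hγ.sameSide_or_oppositeSide h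
  two_sided e he := by
    obtain ⟨e', he', hangle, hspeed⟩ := exists_endAngle_eq (e := (e.1.1, e.2)) e.1.2
      (mt hγ.endPoint_mem_boundary_iff.2 he)
    exact ⟨(⟨e'.1, he'⟩, e'.2), hγ.oppositeSide hangle hspeed⟩

end IsCrossingArc

end ArcCurve

section SlantedArc

theorem hasDerivAt_max_zero_sq (x : ℝ) :
    HasDerivAt (fun x : ℝ => max x 0 ^ 2) (2 * max x 0) x := by
  rcases lt_trichotomy x 0 with hx | rfl | hx
  · rw [max_eq_right hx.le, mul_zero]
    refine (hasDerivAt_const x (0 : ℝ)).congr_of_eventuallyEq ?_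
    filter_upwards [Iio_mem_nhds hx] with y hy
    simp [max_eq_right (mem_Iio.1 hy).le]
  · rw [max_self, mul_zero]
    have hO : (fun x : ℝ => max x 0 ^ 2) =O[𝓝 0] fun x => ‖x - 0‖ ^ 2 :=
      .of_bound' <| .of_forall fun x => by
        simp only [sub_zero, norm_pow, norm_norm]
        exact pow_le_pow_left₀ (norm_nonneg _) (abs_max_le_max_abs_abs.trans (by simp)) 2
    exact (hO.hasFDerivAt one_lt_two).hasDerivAt
  · rw [max_eq_left hx.le]
    refine HasDerivAt.congr_of_eventuallyEq (by simpa using hasDerivAt_pow 2 x) ?_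
    filter_upwards [Ioi_mem_nhds hx] with y hy
    rw [max_eq_left (mem_Ioi.1 hy).le]

/-- The logarithm of the norm along the arc of a standard track, as a function of the angle. -/
def bendHeight (θ : ℝ) : ℝ := max (-θ) 0 ^ 2 - max (θ - Real.pi) 0 ^ 2

/-- The derivative of `bendHeight`. -/
def bendHeightDeriv (θ : ℝ) : ℝ := -(2 * max (-θ) 0) - 2 * max (θ - Real.pi) 0

/-- The height of an arc that is slanted to run strictly inwards with slope at least `d`. The
coefficients keep the end points at height `1` and `-1`. -/
def arcHeight (d θ : ℝ) : ℝ :=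
  d * (Real.pi / 2 - θ) + (1 - d * (Real.pi / 2 + 1)) * bendHeight θ

/-- The derivative of `arcHeight d`. -/
def arcHeightDeriv (d θ : ℝ) : ℝ := -d + (1 - d * (Real.pi / 2 + 1)) * bendHeightDeriv θ

/-- The arc of height `arcHeight d` that turns by `a * θ`: the arc of a standard track for `d = 0`
and `a = ±1`, a radial arc for `a = 0`. -/
def slantedArc (d a θ : ℝ) : ℂ := polar (arcHeight d θ) (a * θ)

theorem hasDerivAt_bendHeight (θ : ℝ) : HasDerivAt bendHeight (bendHeightDeriv θ) θ := by
  have hneg := (hasDerivAt_max_zero_sq (-θ)).comp θ (hasDerivAt_neg θ)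
  have hsub := (hasDerivAt_max_zero_sq (θ - Real.pi)).comp θ ((hasDerivAt_id θ).sub_const Real.pi)
  exact (hneg.sub hsub).congr_deriv (by simp only [bendHeightDeriv]; ring)

theorem hasDerivAt_arcHeight (d θ : ℝ) : HasDerivAt (arcHeight d) (arcHeightDeriv d θ) θ :=
  ((((hasDerivAt_id θ).const_sub _).const_mul d).add
    ((hasDerivAt_bendHeight θ).const_mul _)).congr_deriv (by simp [arcHeightDeriv])

theorem deriv_slantedArc (d a θ : ℝ) :
    deriv (slantedArc d a) θ = slantedArc d a θ * (arcHeightDeriv d θ + a * Complex.I) :=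
  (hasDerivAt_polar (hasDerivAt_arcHeight d θ)
    (((hasDerivAt_id θ).const_mul a).congr_deriv (mul_one a))).deriv

theorem continuous_slantedArc : Continuous fun q : ℝ × ℝ × ℝ => slantedArc q.1 q.2.1 q.2.2 := by
  unfold slantedArc polar arcHeight bendHeight
  fun_prop

theorem continuous_deriv_slantedArc :
    Continuous fun q : ℝ × ℝ × ℝ => deriv (slantedArc q.1 q.2.1) q.2.2 := by
  have := continuous_slantedArc
  simp only [deriv_slantedArc, arcHeightDeriv, bendHeightDeriv]
  fun_prop

theorem contDiff_slantedArc (d a : ℝ) : ContDiff ℝ 1 (slantedArc d a) := by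
  refine contDiff_polar (f := arcHeight d) ?_ (by fun_prop)
  rw [contDiff_one_iff_deriv, funext fun θ => (hasDerivAt_arcHeight d θ).deriv]
  refine ⟨fun θ => (hasDerivAt_arcHeight d θ).differentiableAt, ?_⟩
  unfold arcHeightDeriv bendHeightDeriv
  fun_prop

theorem norm_slantedArc (d a θ : ℝ) : ‖slantedArc d a θ‖ = Real.exp (arcHeight d θ) :=
  norm_polar _ _

theorem antitone_bendHeight : Antitone bendHeight := fun x y h => by
  have hneg := pow_le_pow_left₀ (le_max_right _ _) (max_le_max_right 0 (neg_le_neg h)) 2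
  have hsub := pow_le_pow_left₀ (le_max_right _ _)
    (max_le_max_right 0 (sub_le_sub_right h Real.pi)) 2
  exact sub_le_sub hneg hsub

theorem bendHeight_neg_one : bendHeight (-1) = 1 := by
  simp [bendHeight, max_eq_right (by linarith [Real.pi_pos] : -1 - Real.pi ≤ 0)]

theorem bendHeight_pi_add_one : bendHeight (Real.pi + 1) = -1 := by
  simp [bendHeight, max_eq_right (by linarith [Real.pi_pos] : -1 + -Real.pi ≤ 0)]

theorem arcHeight_neg_one (d : ℝ) : arcHeight d (-1) = 1 := by
  rw [arcHeight, bendHeight_neg_one]; ring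

theorem arcHeight_pi_add_one (d : ℝ) : arcHeight d (Real.pi + 1) = -1 := by
  rw [arcHeight, bendHeight_pi_add_one]; ring

theorem bendHeight_lt_one {θ : ℝ} (hθ : -1 < θ) : bendHeight θ < 1 := by
  have : max (-θ) 0 ^ 2 < 1 :=
    pow_lt_one₀ (le_max_right _ _) (max_lt (by linarith) one_pos) two_ne_zero
  have := sq_nonneg (max (θ - Real.pi) 0)
  rw [bendHeight]; linarith

theorem neg_one_lt_bendHeight {θ : ℝ} (hθ : θ < Real.pi + 1) : -1 < bendHeight θ := by
  have : max (θ - Real.pi) 0 ^ 2 < 1 :=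
    pow_lt_one₀ (le_max_right _ _) (max_lt (by linarith) one_pos) two_ne_zero
  have := sq_nonneg (max (-θ) 0)
  rw [bendHeight]; linarith

theorem bendHeightDeriv_nonpos (θ : ℝ) : bendHeightDeriv θ ≤ 0 := by
  have := le_max_right (-θ) 0
  have := le_max_right (θ - Real.pi) 0
  rw [bendHeightDeriv]; linarith

theorem bendHeightDeriv_neg {θ : ℝ} (hθ : θ = -1 ∨ θ = Real.pi + 1) : bendHeightDeriv θ < 0 := by
  have := le_max_right (-θ) 0
  have := le_max_right (θ - Real.pi) 0
  rw [bendHeightDeriv]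
  rcases hθ with rfl | rfl
  · linarith [le_max_left (-(-1) : ℝ) 0]
  · linarith [le_max_left (Real.pi + 1 - Real.pi) 0]

variable {d a θ : ℝ}

theorem one_sub_slope_mul_pos (hd : d ∈ Icc (0 : ℝ) (1 / 4)) :
    0 < 1 - d * (Real.pi / 2 + 1) := by
  nlinarith [hd.1, hd.2, Real.pi_pos, Real.pi_le_four]

theorem strictAnti_arcHeight (hd : d ∈ Icc (0 : ℝ) (1 / 4)) (hd0 : 0 < d) :
    StrictAnti (arcHeight d) := fun x y h =>
  add_lt_add_of_lt_of_le (mul_lt_mul_of_pos_left (by linarith) hd0)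
    (mul_le_mul_of_nonneg_left (antitone_bendHeight h.le) (one_sub_slope_mul_pos hd).le)

theorem antitone_arcHeight (hd : d ∈ Icc (0 : ℝ) (1 / 4)) : Antitone (arcHeight d) := fun x y h =>
  add_le_add (mul_le_mul_of_nonneg_left (by linarith) hd.1)
    (mul_le_mul_of_nonneg_left (antitone_bendHeight h) (one_sub_slope_mul_pos hd).le)

theorem arcHeight_lt_one (hd : d ∈ Icc (0 : ℝ) (1 / 4)) (hθ : -1 < θ) : arcHeight d θ < 1 := by
  rw [← arcHeight_neg_one d]
  refine add_lt_add_of_le_of_lt (mul_le_mul_of_nonneg_left (by linarith) hd.1)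
    (mul_lt_mul_of_pos_left ?_ (one_sub_slope_mul_pos hd))
  exact (bendHeight_lt_one hθ).trans_eq bendHeight_neg_one.symm

theorem neg_one_lt_arcHeight (hd : d ∈ Icc (0 : ℝ) (1 / 4)) (hθ : θ < Real.pi + 1) :
    -1 < arcHeight d θ := by
  rw [← arcHeight_pi_add_one d]
  refine add_lt_add_of_le_of_lt (mul_le_mul_of_nonneg_left (by linarith) hd.1)
    (mul_lt_mul_of_pos_left ?_ (one_sub_slope_mul_pos hd))
  exact bendHeight_pi_add_one.trans_lt (neg_one_lt_bendHeight hθ)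

theorem arcHeightDeriv_neg (hd : d ∈ Icc (0 : ℝ) (1 / 4))
    (h : 0 < d ∨ θ = -1 ∨ θ = Real.pi + 1) : arcHeightDeriv d θ < 0 := by
  have hpos := one_sub_slope_mul_pos hd
  rw [arcHeightDeriv]
  rcases h with h | h
  · linarith [mul_nonpos_of_nonneg_of_nonpos hpos.le (bendHeightDeriv_nonpos θ)]
  · linarith [mul_neg_of_pos_of_neg hpos (bendHeightDeriv_neg h), hd.1]

theorem eq_of_polar_eq {s s' x y : ℝ} (h : polar s x = polar s' y) (hxy : |x - y| < 2 * Real.pi) :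
    x = y := by
  obtain ⟨n, hn⟩ := Complex.exp_eq_exp_iff_exists_int.1 h
  have him : x - y = n * (2 * Real.pi) := by
    have him := congrArg Complex.im hn
    simp only [Complex.add_im, Complex.ofReal_im, Complex.mul_im, Complex.ofReal_re, Complex.I_im,
      mul_one, Complex.I_re, mul_zero, add_zero, zero_add, Complex.intCast_re, Complex.mul_re,
      Complex.re_ofNat, Complex.im_ofNat, sub_zero, zero_mul, Complex.intCast_im, sub_self] at him
    linarith
  rw [him, abs_mul, abs_of_pos Real.two_pi_pos, ← lt_div_iff₀ Real.two_pi_pos,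
    div_self Real.two_pi_pos.ne'] at hxy
  have hn0 : n = 0 := Int.abs_lt_one_iff.1 (by exact_mod_cast hxy)
  simpa [hn0, sub_eq_zero] using him

theorem injOn_slantedArc (hd : d ∈ Icc (0 : ℝ) (1 / 4)) (h : 0 < d ∨ |a| = 1) :
    InjOn (slantedArc d a) (Icc (-1) (Real.pi + 1)) := by
  intro x hx y hy hxy
  rcases h with h | h
  · have hheight := congrArg norm hxy
    rw [norm_slantedArc, norm_slantedArc, Real.exp_eq_exp] at hheight
    exact (strictAnti_arcHeight hd h).injective hheight
  · refine mul_left_cancel₀ (abs_ne_zero.1 (h ▸ one_ne_zero)) (eq_of_polar_eq hxy ?_)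
    rw [← mul_sub, abs_mul, h, one_mul, abs_lt]
    constructor <;> linarith [hx.1, hx.2, hy.1, hy.2, Real.pi_gt_three]

theorem inner_mul_self_mul (z : ℂ) (r a : ℝ) :
    inner ℝ z (z * (r + a * Complex.I)) = r * Complex.normSq z := by
  simp only [Complex.inner, Complex.mul_re, Complex.add_re, Complex.ofReal_re, Complex.I_re,
    mul_zero, Complex.ofReal_im, Complex.I_im, mul_one, sub_self, add_zero, Complex.add_im,
    Complex.mul_im, zero_add, Complex.conj_re, Complex.conj_im, mul_neg, sub_neg_eq_add,
    Complex.normSq_apply]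
  ring

theorem isCrossingArc_slantedArc (hd : d ∈ Icc (0 : ℝ) (1 / 4)) (h : 0 < d ∨ |a| = 1) :
    IsCrossingArc (slantedArc d a) := by
  have hends : ∀ θ ∈ Icc (-1) (Real.pi + 1),
      slantedArc d a θ ∈ connectorBoundary ↔ θ = -1 ∨ θ = Real.pi + 1 := fun θ hθ => by
    simp only [connectorBoundary, outerBoundary, innerBoundary, mem_union, mem_ofPred_eq,
      norm_slantedArc, Real.exp_eq_exp]
    refine or_congr ⟨fun h1 => ?_, ?_⟩ ⟨fun h1 => ?_, ?_⟩
    · exact hθ.1.eq_of_not_lt' fun hlt => (arcHeight_lt_one hd hlt).ne h1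
    · rintro rfl; exact arcHeight_neg_one d
    · exact hθ.2.eq_of_not_lt fun hlt => (neg_one_lt_arcHeight hd hlt).ne' h1
    · rintro rfl; exact arcHeight_pi_add_one d
  refine ⟨contDiff_slantedArc d a, fun θ _ h0 => ?_, fun θ hθ => ?_, injOn_slantedArc hd h, hends,
    fun θ hθ hmem => ?_⟩
  · rw [deriv_slantedArc] at h0
    have hspeed := (mul_eq_zero.1 h0).resolve_left (polar_ne_zero _ _)
    rcases h with h | h
    · exact (arcHeightDeriv_neg hd (.inl h)).ne (by simpa using congrArg Complex.re hspeed)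
    · exact abs_ne_zero.1 (h ▸ one_ne_zero) (by simpa using congrArg Complex.im hspeed)
  · rw [connector, mem_ofPred_eq, norm_slantedArc, Real.exp_le_exp, Real.exp_le_exp]
    exact ⟨(arcHeight_pi_add_one d).symm.trans_le (antitone_arcHeight hd hθ.2),
      (antitone_arcHeight hd hθ.1).trans_eq (arcHeight_neg_one d)⟩
  · rw [deriv_slantedArc, inner_mul_self_mul]
    exact mul_ne_zero (arcHeightDeriv_neg hd (.inr ((hends θ hθ).1 hmem))).ne
      (Complex.normSq_pos.2 (polar_ne_zero _ _)).ne'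

theorem arcCurve_slantedArc_eq_connectorCurve (k : Bool) (b : arcBranches) {u : ℝ}
    (hu : u ∈ Icc (0 : ℝ) 1) :
    arcCurve (slantedArc 0 (turn k)) b u = connectorCurve k b u := by
  have hπ := Real.pi_pos
  have hcurve : arcCurve (slantedArc 0 (turn k)) b u =
      polar (bendHeight (arcAngle b u)) (turn k * arcAngle b u) := by
    simp [arcCurve, slantedArc, arcHeight]
  rw [hcurve]
  obtain ⟨b, hb⟩ := b
  cases b
  case short => exact absurd hb (by decide)
  case outer =>
    have hpi : -u - Real.pi ≤ 0 := by linarith [hu.1]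
    simp [connectorCurve, bendHeight, arcAngle, arcSpeed, hu.1, hpi]
  case inner =>
    have hneg : -u + -Real.pi ≤ 0 := by linarith [hu.1]
    simp [connectorCurve, bendHeight, arcAngle, arcSpeed, hu.1, hneg]
  case long =>
    have hneg : 0 ≤ Real.pi * u := mul_nonneg hπ.le hu.1
    have hpi : Real.pi * u ≤ Real.pi := mul_le_of_le_one_right hπ.le hu.2
    simp [connectorCurve, bendHeight, arcAngle, arcSpeed, hneg, hpi]

end SlantedArc

section ArcIsotopy

/-- The arc of one standard track is unwound to a radial arc and wound up to the other side. In
between it is slanted, which keeps it embedded. -/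
def arcFamily (s : ℝ) : ℝ → ℂ := slantedArc (s * (1 - s)) (1 - 2 * s)

theorem isCrossingArc_arcFamily {s : ℝ} (hs : s ∈ Icc (0 : ℝ) 1) : IsCrossingArc (arcFamily s) := by
  obtain ⟨h0, h1⟩ := hs
  refine isCrossingArc_slantedArc ⟨by nlinarith, by nlinarith [sq_nonneg (2 * s - 1)]⟩ ?_
  rcases h0.eq_or_lt with rfl | h0
  · simp
  rcases h1.eq_or_lt with rfl | h1
  · norm_num
  exact .inl (mul_pos h0 (sub_pos.2 h1))

theorem arcCurve_arcFamily_zero (b : arcBranches) {u : ℝ} (hu : u ∈ Icc (0 : ℝ) 1) :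
    arcCurve (arcFamily 0) b u = connectorCurve false b u := by
  simpa [arcFamily, turn] using arcCurve_slantedArc_eq_connectorCurve false b hu

theorem arcCurve_arcFamily_one (b : arcBranches) {u : ℝ} (hu : u ∈ Icc (0 : ℝ) 1) :
    arcCurve (arcFamily 1) b u = connectorCurve true b u := by
  rw [← arcCurve_slantedArc_eq_connectorCurve true b hu]
  norm_num [arcFamily, turn]

theorem continuous_arcCurve_arcFamily (b : arcBranches) :
    Continuous fun p : ℝ × ℝ => arcCurve (arcFamily p.1) b p.2 := by
  refine continuous_slantedArc.comp (f := fun p : ℝ × ℝ =>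
    (p.1 * (1 - p.1), 1 - 2 * p.1, arcAngle b p.2)) ?_
  unfold arcAngle
  fun_prop

theorem continuousOn_deriv_arcCurve_arcFamily (b : arcBranches) :
    ContinuousOn (fun p : ℝ × ℝ => deriv (arcCurve (arcFamily p.1) b) p.2)
      (Icc (0 : ℝ) 1 ×ˢ Icc (0 : ℝ) 1) := by
  have hcont : Continuous fun p : ℝ × ℝ => deriv (arcFamily p.1) (arcAngle b p.2) := by
    refine continuous_deriv_slantedArc.comp (f := fun p : ℝ × ℝ =>
      (p.1 * (1 - p.1), 1 - 2 * p.1, arcAngle b p.2)) ?_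
    unfold arcAngle
    fun_prop
  exact (hcont.const_smul (arcSpeed b)).continuousOn.congr fun p hp =>
    (isCrossingArc_arcFamily hp.1).deriv_arcCurve b p.2

theorem endPoint_arcFamily_eq_iff {s : ℝ} (hs : s ∈ Icc (0 : ℝ) 1) (e e' : arcBranches × Bool) :
    endPoint (arcCurve (arcFamily s)) e = endPoint (arcCurve (arcFamily s)) e' ↔
      endPoint (connectorCurve false) (e.1, e.2) =
        endPoint (connectorCurve false) (e'.1, e'.2) := by
  have hzero (e : arcBranches × Bool) :
      endPoint (connectorCurve false) (e.1, e.2) = endPoint (arcCurve (arcFamily 0)) e :=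
    (arcCurve_arcFamily_zero e.1 (by split_ifs <;> simp)).symm
  rw [hzero e, hzero e', (isCrossingArc_arcFamily hs).endPoint_eq_iff,
    (isCrossingArc_arcFamily ⟨le_rfl, zero_le_one⟩).endPoint_eq_iff]

/-- The isotopy between the arcs of the two standard tracks. -/
def arcIsotopy :
    ((connectorTrack false).sub arcBranches (isFullSubtrack_arcBranches false).1).Isotopy
      ((connectorTrack true).sub arcBranches (isFullSubtrack_arcBranches true).1) where
  family s := arcCurve (arcFamily s)
  branchEquiv := Equiv.refl arcBranches
  isTrainTrack _ hs := (isCrossingArc_arcFamily hs).isTrainTrack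
  continuousOn b := (continuous_arcCurve_arcFamily b).continuousOn
  continuousOn_deriv := continuousOn_deriv_arcCurve_arcFamily
  incidence _ hs := endPoint_arcFamily_eq_iff hs
  start b _ := arcCurve_arcFamily_zero b
  finish b := image_congr fun _ => arcCurve_arcFamily_one b

theorem connectorWeight_zero_of_mem_arcBranches {y : ℝ} {b : ConnectorBranch}
    (hb : b ∈ arcBranches) : connectorWeight 0 y b = y := by
  cases b <;> simp [arcBranches, connectorWeight] at hb ⊢

theorem connectorWeight_zero_of_notMem_arcBranches {y : ℝ} {b : ConnectorBranch}
    (hb : b ∉ arcBranches) : connectorWeight 0 y b = 0 := by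
  cases b <;> simp [arcBranches, connectorWeight] at hb ⊢

theorem glue_arc (y : ℝ) :
    Glue connectorCollection (wholeIndex (isFull_connectorTrack false))
      (wholeIndex (isFull_connectorTrack true))
      (wholeWeight (isFull_connectorTrack false) (connectorWeight 0 y))
      (wholeWeight (isFull_connectorTrack true) (connectorWeight 0 y)) :=
  glue_wholeWeight_of_isotopy _ _ (isFullSubtrack_arcBranches _) (isFullSubtrack_arcBranches _)
    arcIsotopy
    (fun _ => connectorWeight_zero_of_notMem_arcBranches)
    (fun _ => connectorWeight_zero_of_notMem_arcBranches) fun d =>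
    (connectorWeight_zero_of_mem_arcBranches (arcIsotopy.branchEquiv d : arcBranches).2).trans
      (connectorWeight_zero_of_mem_arcBranches d.2).symm

end ArcIsotopy

/-! ### Invariance of the weights and of the sense of turning -/

section Invariance

variable {k k' : Bool} {V W : ConnectorBranch → ℝ}

theorem sum_connectorWeight (t y : ℝ) : ∑ b, connectorWeight t y b = 2 * t + 3 * y := by
  rw [sum_connectorBranch]
  simp only [connectorWeight]
  ring

theorem le_long_of_mem_weightCone (hV : V ∈ (connectorTrack k).weightCone) (b : ConnectorBranch) :
    V b ≤ V .long := by
  obtain ⟨⟨ht, hy⟩, hV⟩ := mem_weightCone_connectorTrack_iff.1 hV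
  rw [hV]
  cases b <;> simp only [connectorWeight] <;> linarith

theorem eq_long_of_mem_weightCone (hV : V ∈ (connectorTrack k).weightCone) (hs : 0 < V .short)
    (ho : 0 < V .outer) {b : ConnectorBranch} (hb : V b = V .long) : b = .long := by
  rw [(mem_weightCone_connectorTrack_iff.1 hV).2] at hb
  cases b <;> simp only [connectorWeight] at hb <;> first | rfl | linarith

theorem Glue.long_le_long (h : Glue connectorTrack k k' V W)
    (hW : W ∈ (connectorTrack k').weightCone) : V .long ≤ W .long := by
  by_cases h0 : V .long = 0
  · exact h0.trans_le (hW.1 _)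
  · obtain ⟨b', hb'⟩ := h.exists_eq_of_ne_zero (b := ConnectorBranch.long) h0
    exact hb'.symm.trans_le (le_long_of_mem_weightCone hW b')

theorem Glue.long_le_long' (h : Glue connectorTrack k k' V W)
    (hV : V ∈ (connectorTrack k).weightCone) : W .long ≤ V .long := by
  by_cases h0 : W .long = 0
  · exact h0.trans_le (hV.1 _)
  · obtain ⟨b, hb⟩ := h.exists_eq_of_ne_zero' (b' := ConnectorBranch.long) h0
    exact hb.symm.trans_le (le_long_of_mem_weightCone hV b)

theorem Glue.eq_of_mem_weightCone (h : Glue connectorTrack k k' V W)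
    (hV : V ∈ (connectorTrack k).weightCone) (hW : W ∈ (connectorTrack k').weightCone) :
    V = W := by
  have hlong := (h.long_le_long hW).antisymm (h.long_le_long' hV)
  have hsum : ∑ b, V b = ∑ b, W b := h.sum_eq
  obtain ⟨-, hV⟩ := mem_weightCone_connectorTrack_iff.1 hV
  obtain ⟨-, hW⟩ := mem_weightCone_connectorTrack_iff.1 hW
  rw [hV, hW, sum_connectorWeight, sum_connectorWeight] at hsum
  rw [hV, hW] at hlong
  simp only [connectorWeight] at hlong
  rw [hV, hW]
  congr 1 <;> linarith

theorem Glue.turn_eq (h : Glue connectorTrack k k' V W) (hV : V ∈ (connectorTrack k).weightCone)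
    (hW : W ∈ (connectorTrack k').weightCone) (hs : 0 < V .short) (ho : 0 < V .outer) :
    k = k' := by
  obtain rfl := h.eq_of_mem_weightCone hV hW
  have hpos : ∀ b, V b ≠ 0 := fun b => by
    rw [(mem_weightCone_connectorTrack_iff.1 hV).2]
    cases b <;> simp only [connectorWeight] <;> positivity
  obtain ⟨A, B, _, _, φ, -, -, hA, hB, hφ⟩ := h
  let f : A ≃ ConnectorBranch := Equiv.subtypeUnivEquiv fun b => not_not.1 (mt (hA b) (hpos b))
  let g : B ≃ ConnectorBranch := Equiv.subtypeUnivEquiv fun b => not_not.1 (mt (hB b) (hpos b))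
  exact turn_eq_of_isotopy (φ.reindex f.symm (fun _ => rfl) g fun _ => rfl)
    (eq_long_of_mem_weightCone hV hs ho (hφ (f.symm .long)))

end Invariance

/-! ### Plane coordinates on the glued spaces -/

section PlaneCoordinates

/-- The coordinates `(t - y, ± min t y)` of the weight vector with parameters `(t, y)`. They map the
quadrants of the two standard tracks onto the upper and the lower half plane. -/
def planeCoord (k : Bool) (W : ConnectorBranch → ℝ) : ℝ × ℝ :=
  (W .short - W .outer, turn k * min (W .short) (W .outer))

/-- The parameter `t`, the weight of the short half circle, at a point of the plane. -/
def shortWeight (p : ℝ × ℝ) : ℝ := |p.2| + max p.1 0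

/-- The parameter `y`, the weight of the two arcs, at a point of the plane. -/
def crossWeight (p : ℝ × ℝ) : ℝ := |p.2| + max (-p.1) 0

/-- The weight vector at a point of the plane. -/
def planeWeight (p : ℝ × ℝ) : ConnectorBranch → ℝ := connectorWeight (shortWeight p) (crossWeight p)

theorem shortWeight_nonneg (p : ℝ × ℝ) : 0 ≤ shortWeight p :=
  add_nonneg (abs_nonneg _) (le_max_right _ _)

theorem crossWeight_nonneg (p : ℝ × ℝ) : 0 ≤ crossWeight p :=
  add_nonneg (abs_nonneg _) (le_max_right _ _)

theorem planeWeight_mem_weightCone (k : Bool) (p : ℝ × ℝ) :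
    planeWeight p ∈ (connectorTrack k).weightCone :=
  connectorWeight_mem_weightCone (shortWeight_nonneg p) (crossWeight_nonneg p)

theorem continuous_crossWeight : Continuous crossWeight := by
  unfold crossWeight
  fun_prop

theorem continuous_planeWeight : Continuous planeWeight := by
  refine continuous_pi fun b => ?_
  cases b <;> simp only [planeWeight, connectorWeight, shortWeight, crossWeight] <;> fun_prop

theorem continuous_planeCoord (k : Bool) : Continuous (planeCoord k) := by
  unfold planeCoord
  fun_prop

theorem abs_turn_mul (k : Bool) (x : ℝ) : |turn k * x| = |x| := by
  rcases turn_cases k with h | h <;> simp [h]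

theorem exists_turn_mul_nonneg (x : ℝ) : ∃ k, 0 ≤ turn k * x := by
  rcases le_total 0 x with h | h
  · exact ⟨false, by simpa [turn] using h⟩
  · exact ⟨true, by simpa [turn] using h⟩

theorem shortWeight_planeCoord (k : Bool) {W : ConnectorBranch → ℝ} (hs : 0 ≤ W .short)
    (ho : 0 ≤ W .outer) : shortWeight (planeCoord k W) = W .short := by
  rw [shortWeight, planeCoord, abs_turn_mul, abs_of_nonneg (le_min hs ho), ← max_add_add_left,
    add_zero, add_sub_left_comm]
  rcases le_total (W .short) (W .outer) with h | h
  · rw [min_eq_left h, max_eq_right (by linarith)]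
  · rw [min_eq_right h, max_eq_left (by linarith)]
    ring

theorem crossWeight_planeCoord (k : Bool) {W : ConnectorBranch → ℝ} (hs : 0 ≤ W .short)
    (ho : 0 ≤ W .outer) : crossWeight (planeCoord k W) = W .outer := by
  rw [crossWeight, planeCoord, abs_turn_mul, abs_of_nonneg (le_min hs ho)]
  rcases le_total (W .short) (W .outer) with h | h
  · rw [min_eq_left h, max_eq_left (by linarith)]
    ring
  · rw [min_eq_right h, max_eq_right (by linarith), add_zero]

theorem planeWeight_planeCoord {k : Bool} {W : ConnectorBranch → ℝ}
    (hW : W ∈ (connectorTrack k).weightCone) : planeWeight (planeCoord k W) = W := by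
  obtain ⟨⟨hs, ho⟩, hW⟩ := mem_weightCone_connectorTrack_iff.1 hW
  rw [planeWeight, shortWeight_planeCoord k hs ho, crossWeight_planeCoord k hs ho, ← hW]

theorem planeCoord_planeWeight (k : Bool) (p : ℝ × ℝ) :
    planeCoord k (planeWeight p) = (p.1, turn k * |p.2|) := by
  simp only [planeCoord, planeWeight, connectorWeight, shortWeight, crossWeight]
  rcases le_total p.1 0 with h | h
  · rw [max_eq_right h, max_eq_left (by linarith), min_eq_left (by linarith)]
    ring_nf
  · rw [max_eq_left h, max_eq_right (by linarith), min_eq_right (by linarith)]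
    ring_nf

theorem planeCoord_planeWeight_of_nonneg {k : Bool} {p : ℝ × ℝ} (h : 0 ≤ turn k * p.2) :
    planeCoord k (planeWeight p) = p := by
  rw [planeCoord_planeWeight, ← abs_turn_mul k, abs_of_nonneg h, ← mul_assoc, turn_mul_self,
    one_mul]

theorem turn_mul_snd_planeCoord_nonneg {k : Bool} {W : ConnectorBranch → ℝ}
    (hW : W ∈ (connectorTrack k).weightCone) : 0 ≤ turn k * (planeCoord k W).2 := by
  obtain ⟨⟨hs, ho⟩, -⟩ := mem_weightCone_connectorTrack_iff.1 hW
  rw [planeCoord, ← mul_assoc, turn_mul_self, one_mul]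
  exact le_min hs ho

theorem Glue.planeCoord_eq {k k' : Bool} {V W : ConnectorBranch → ℝ}
    (h : Glue connectorTrack k k' V W) (hV : V ∈ (connectorTrack k).weightCone)
    (hW : W ∈ (connectorTrack k').weightCone) : planeCoord k V = planeCoord k' W := by
  obtain rfl := h.eq_of_mem_weightCone hV hW
  by_cases hpos : 0 < V .short ∧ 0 < V .outer
  · rw [h.turn_eq hV hW hpos.1 hpos.2]
  · have hmin : min (V .short) (V .outer) = 0 :=
      (le_of_not_gt fun h0 => hpos (lt_min_iff.1 h0)).antisymm (le_min (hV.1 _) (hV.1 _))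
    rw [planeCoord, planeCoord, hmin, mul_zero, mul_zero]

theorem glue_wholeWeight_planeWeight {p : ℝ × ℝ} (hp : p.2 = 0) :
    Glue connectorCollection (wholeIndex (isFull_connectorTrack false))
      (wholeIndex (isFull_connectorTrack true))
      (wholeWeight (isFull_connectorTrack false) (planeWeight p))
      (wholeWeight (isFull_connectorTrack true) (planeWeight p)) := by
  rw [planeWeight, shortWeight, crossWeight, hp, abs_zero, zero_add, zero_add]
  rcases le_total 0 p.1 with h | h
  · rw [max_eq_right (neg_nonpos.2 h)]
    exact glue_core _
  · rw [max_eq_right h]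
    exact glue_arc _

end PlaneCoordinates

section GluedSpace

/-- The disjoint union of subsets `C i` of the weight spaces of the members of `𝒯`, glued along
common full sub-train-tracks. The spaces `ℳ_𝒯` and `𝒫ℳ_𝒯` are the cases of the cones and of the
projectivized cones. -/
abbrev GluedSpace {ι : Type} (𝒯 : ι → TrainTrack) (C : ∀ i, Set ((𝒯 i).Branch → ℝ)) : Type :=
  Quot fun x y : Σ i, C i => Glue 𝒯 x.1 y.1 (x.2 : _ → ℝ) (y.2 : _ → ℝ)

theorem continuous_ambientWeight {κ : Type} {τ : κ → TrainTrack} (i : SubtrackIndex τ) :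
    Continuous (ambientWeight τ i) :=
  LinearMap.continuous_of_finiteDimensional _

variable {C : ∀ i : SubtrackIndex connectorTrack, Set ((connectorCollection i).Branch → ℝ)}
  {T : Set (ConnectorBranch → ℝ)}
  (hC : ∀ i w, w ∈ C i ↔
    w ∈ (connectorCollection i).weightCone ∧ ambientWeight connectorTrack i w ∈ T)

include hC

theorem ambientWeight_mem_weightCone {i : SubtrackIndex connectorTrack}
    {w : (connectorCollection i).Branch → ℝ} (hw : w ∈ C i) :
    ambientWeight connectorTrack i w ∈ (connectorTrack i.1).weightCone :=
  (ambientWeight_mem_weightCone_iff i w).2 ((hC i w).1 hw).1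

theorem wholeWeight_planeWeight_mem (k : Bool) {p : ℝ × ℝ} (hp : planeWeight p ∈ T) :
    wholeWeight (isFull_connectorTrack k) (planeWeight p) ∈
      C (wholeIndex (isFull_connectorTrack k)) := by
  have h := ambientWeight_wholeWeight (isFull_connectorTrack k) (planeWeight p)
  exact (hC _ _).2 ⟨(ambientWeight_mem_weightCone_iff _ _).1
    (mem_of_eq_of_mem h (planeWeight_mem_weightCone k p)), mem_of_eq_of_mem h hp⟩

namespace GluedSpace

/-- The coordinates of a point of the glued space. -/
def toPlane (x : GluedSpace connectorCollection C) : planeWeight ⁻¹' T :=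
  x.lift
    (fun x => ⟨planeCoord x.1.1 (ambientWeight connectorTrack x.1 x.2), by
      rw [mem_preimage, planeWeight_planeCoord (ambientWeight_mem_weightCone hC x.2.2)]
      exact ((hC _ _).1 x.2.2).2⟩)
    fun x y h => Subtype.ext <| h.ambientWeight.planeCoord_eq
      (ambientWeight_mem_weightCone hC x.2.2) (ambientWeight_mem_weightCone hC y.2.2)

/-- The point of the glued space that is represented by the weight vector at a point of the plane on
the standard track with a given sense of turning. -/
def ofPlane (k : Bool) (p : planeWeight ⁻¹' T) : GluedSpace connectorCollection C :=
  Quot.mk _ ⟨wholeIndex (isFull_connectorTrack k), _, wholeWeight_planeWeight_mem hC k p.2⟩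

theorem continuous_toPlane : Continuous (toPlane hC) := by
  refine continuous_quot_lift _ (continuous_sigma fun i => Continuous.subtype_mk ?_ _)
  exact (continuous_planeCoord i.1).comp ((continuous_ambientWeight i).comp continuous_subtype_val)

theorem continuous_ofPlane (k : Bool) : Continuous (ofPlane hC k) := by
  refine continuous_quot_mk.comp (continuous_sigmaMk.comp (Continuous.subtype_mk ?_ _))
  exact continuous_pi fun b => (continuous_apply _).comp
    (continuous_planeWeight.comp continuous_subtype_val)

theorem toPlane_ofPlane {k : Bool} {p : planeWeight ⁻¹' T} (hp : 0 ≤ turn k * p.1.2) :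
    toPlane hC (ofPlane hC k p) = p := by
  refine Subtype.ext (Eq.trans ?_ (planeCoord_planeWeight_of_nonneg hp))
  exact congrArg (planeCoord k)
    (ambientWeight_wholeWeight (isFull_connectorTrack k) (planeWeight p.1))

theorem ofPlane_toPlane_mk (x : Σ i, C i) :
    ofPlane hC x.1.1 (toPlane hC (Quot.mk _ x)) = Quot.mk _ x := by
  obtain ⟨i, w, hw⟩ := x
  refine (Quot.sound ?_).symm
  change Glue _ i (wholeIndex (isFull_connectorTrack i.1)) w
    (wholeWeight _ (planeWeight (planeCoord i.1 (ambientWeight connectorTrack i w))))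
  rw [planeWeight_planeCoord (ambientWeight_mem_weightCone hC hw)]
  exact glue_wholeWeight i _ w

theorem ofPlane_false_eq_ofPlane_true {p : planeWeight ⁻¹' T} (hp : p.1.2 = 0) :
    ofPlane hC false p = ofPlane hC true p :=
  Quot.sound (glue_wholeWeight_planeWeight hp)

theorem ite_ofPlane {k : Bool} {p : planeWeight ⁻¹' T} (hp : 0 ≤ turn k * p.1.2) :
    (if 0 ≤ p.1.2 then ofPlane hC false p else ofPlane hC true p) = ofPlane hC k p := by
  cases k
  · rw [turn, if_neg Bool.false_ne_true, one_mul] at hp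
    exact if_pos hp
  · rw [turn, if_pos rfl, neg_one_mul, neg_nonneg] at hp
    split_ifs with h
    · exact ofPlane_false_eq_ofPlane_true hC (hp.antisymm h)
    · rfl

/-- The glued space is homeomorphic to a region in the plane. -/
def homeomorphPlane : GluedSpace connectorCollection C ≃ₜ (planeWeight ⁻¹' T) where
  toFun := toPlane hC
  invFun p := if 0 ≤ p.1.2 then ofPlane hC false p else ofPlane hC true p
  left_inv := by
    rintro ⟨x⟩
    have hx := turn_mul_snd_planeCoord_nonneg (ambientWeight_mem_weightCone hC x.2.2)
    exact (ite_ofPlane hC hx).trans (ofPlane_toPlane_mk hC x)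
  right_inv p := by
    obtain ⟨k, hk⟩ := exists_turn_mul_nonneg p.1.2
    exact (congrArg _ (ite_ofPlane hC hk)).trans (toPlane_ofPlane hC hk)
  continuous_toFun := continuous_toPlane hC
  continuous_invFun := (continuous_ofPlane hC false).if_le (continuous_ofPlane hC true)
    continuous_const (continuous_snd.comp continuous_subtype_val)
    fun _ hp => ofPlane_false_eq_ofPlane_true hC hp.symm

end GluedSpace

end GluedSpace

/-- The space of measured laminations is homeomorphic to the plane. -/
def mlHomeomorph : MLSpace connectorCollection ≃ₜ ℝ × ℝ :=
  (GluedSpace.homeomorphPlane (C := fun i => (connectorCollection i).weightCone) (T := univ)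
    fun _ _ => (and_iff_left trivial).symm).trans (Homeomorph.Set.univ (ℝ × ℝ))

/-! ### The space of projective measured laminations -/

section LevelSet

variable {E : Type*} [NormedAddCommGroup E] [NormedSpace ℝ E] {N : E → ℝ}

theorem norm_ne_zero_of_apply_eq_one (hsmul : ∀ (r : ℝ) (x : E), 0 < r → N (r • x) = r * N x)
    (x : {x | N x = 1}) : ‖x.1‖ ≠ 0 := fun h => by
  have hzero : N 0 = 0 := by simpa [two_mul] using hsmul 2 0 zero_lt_two
  exact zero_ne_one (hzero.symm.trans (norm_eq_zero.1 h ▸ x.2))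

theorem apply_inv_norm_smul (hsmul : ∀ (r : ℝ) (x : E), 0 < r → N (r • x) = r * N x)
    (x : {x | N x = 1}) : N (‖x.1‖⁻¹ • x.1) = ‖x.1‖⁻¹ := by
  have hx : N x = 1 := x.2
  rw [hsmul _ _ (inv_pos.2 ((norm_nonneg _).lt_of_ne' (norm_ne_zero_of_apply_eq_one hsmul x))), hx,
    mul_one]

theorem norm_inv_apply_smul (hpos : ∀ x, x ≠ 0 → 0 < N x) (z : Metric.sphere (0 : E) 1) :
    ‖(N z)⁻¹ • z.1‖ = (N z)⁻¹ := by
  rw [norm_smul, norm_eq_of_mem_sphere, mul_one,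
    Real.norm_of_nonneg (inv_pos.2 (hpos z (ne_zero_of_mem_unit_sphere z))).le]

/-- The radial projection of a level set of a positively homogeneous function, which is positive
away from the origin, onto the unit sphere. -/
def levelSetHomeomorphSphere (hcont : Continuous N)
    (hsmul : ∀ (r : ℝ) (x : E), 0 < r → N (r • x) = r * N x) (hpos : ∀ x, x ≠ 0 → 0 < N x) :
    {x | N x = 1} ≃ₜ Metric.sphere (0 : E) 1 where
  toFun x := ⟨‖x.1‖⁻¹ • x.1, mem_sphere_zero_iff_norm.2 <| by
    rw [norm_smul, norm_inv, norm_norm, inv_mul_cancel₀ (norm_ne_zero_of_apply_eq_one hsmul x)]⟩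
  invFun z := ⟨(N z)⁻¹ • z.1,
    have hz := hpos z (ne_zero_of_mem_unit_sphere z)
    (hsmul _ _ (inv_pos.2 hz)).trans (inv_mul_cancel₀ hz.ne')⟩
  left_inv x := Subtype.ext <| by
    dsimp only
    rw [apply_inv_norm_smul hsmul, inv_inv, smul_inv_smul₀ (norm_ne_zero_of_apply_eq_one hsmul x)]
  right_inv z := Subtype.ext <| by
    dsimp only
    rw [norm_inv_apply_smul hpos, inv_inv,
      smul_inv_smul₀ (hpos z (ne_zero_of_mem_unit_sphere z)).ne']
  continuous_toFun := (((continuous_norm.comp continuous_subtype_val).inv₀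
    (norm_ne_zero_of_apply_eq_one hsmul)).smul continuous_subtype_val).subtype_mk _
  continuous_invFun := (((hcont.comp continuous_subtype_val).inv₀ fun z : Metric.sphere (0 : E) 1 =>
    (hpos z (ne_zero_of_mem_unit_sphere z)).ne').smul continuous_subtype_val).subtype_mk _

end LevelSet

section Projective

/-- The sum of the weights on all branches at a point of the plane. -/
def totalWeight (p : ℝ × ℝ) : ℝ := ∑ b, planeWeight p b

theorem totalWeight_eq (p : ℝ × ℝ) : totalWeight p = 2 * shortWeight p + 3 * crossWeight p :=
  sum_connectorWeight _ _

theorem continuous_totalWeight : Continuous totalWeight :=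
  continuous_finsetSum _ fun b _ => (continuous_apply b).comp continuous_planeWeight

theorem totalWeight_smul {r : ℝ} (hr : 0 ≤ r) (p : ℝ × ℝ) :
    totalWeight (r • p) = r * totalWeight p := by
  have hmax : ∀ x : ℝ, max (r * x) 0 = r * max x 0 := fun x => by
    rw [mul_max_of_nonneg _ _ hr, mul_zero]
  simp only [totalWeight_eq, shortWeight, crossWeight, Prod.smul_fst, Prod.smul_snd, smul_eq_mul,
    abs_mul, abs_of_nonneg hr, hmax, ← mul_neg]
  ring

theorem shortWeight_add_crossWeight (p : ℝ × ℝ) :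
    shortWeight p + crossWeight p = 2 * |p.2| + |p.1| := by
  rcases le_total 0 p.1 with h | h
  · rw [shortWeight, crossWeight, max_eq_left h, max_eq_right (neg_nonpos.2 h), abs_of_nonneg h]
    ring
  · rw [shortWeight, crossWeight, max_eq_right h, max_eq_left (neg_nonneg.2 h), abs_of_nonpos h]
    ring

theorem totalWeight_pos {p : ℝ × ℝ} (hp : p ≠ 0) : 0 < totalWeight p := by
  have hadd := shortWeight_add_crossWeight p
  have hnorm : 0 < 2 * |p.2| + |p.1| := by
    by_contra! h
    exact hp (Prod.ext (abs_nonpos_iff.1 (by linarith [abs_nonneg p.2]))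
      (abs_nonpos_iff.1 (by linarith [abs_nonneg p.1])))
  rw [totalWeight_eq]
  linarith [shortWeight_nonneg p, crossWeight_nonneg p]

/-- The functional `totalWeight` on the plane of complex numbers. -/
def complexTotalWeight (z : ℂ) : ℝ := totalWeight (Complex.equivRealProdCLM z)

/-- The unit level set of `totalWeight` is homeomorphic to the circle. -/
def totalWeightLevelHomeomorph : (planeWeight ⁻¹' {W | ∑ b, W b = 1}) ≃ₜ Circle :=
  (Complex.equivRealProdCLM.symm.toHomeomorph.subtype (q := fun z => complexTotalWeight z = 1)
    fun p => Eq.to_iff (congrArg (fun p => totalWeight p = 1)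
      (Complex.equivRealProdCLM.apply_symm_apply p).symm)).trans
    (levelSetHomeomorphSphere (N := complexTotalWeight)
      (continuous_totalWeight.comp Complex.equivRealProdCLM.continuous)
      (fun r z hr => by rw [complexTotalWeight, map_smul, totalWeight_smul hr.le]; rfl)
      fun z hz => totalWeight_pos (Complex.equivRealProdCLM.map_ne_zero_iff.2 hz))

/-- The space of projective measured laminations is homeomorphic to the circle. -/
def pmlHomeomorph : PMLSpace connectorCollection ≃ₜ Circle :=
  (GluedSpace.homeomorphPlane (C := fun i => (connectorCollection i).projWeightCone)
    (T := {W | ∑ b, W b = 1}) fun i w => and_congr_right fun _ =>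
      Eq.to_iff (congrArg (· = 1) (sum_ambientWeight i w).symm)).trans totalWeightLevelHomeomorph

end Projective

/-! ### Piecewise linearity -/

section Polyhedra

variable {E F : Type} [NormedAddCommGroup E] [NormedSpace ℝ E]
  [NormedAddCommGroup F] [NormedSpace ℝ F]

theorem IsPolyhedron.iInter {ι : Type*} [Finite ι] {P : ι → Set E} (hP : ∀ i, IsPolyhedron (P i)) :
    IsPolyhedron (⋂ i, P i) := by
  classical
  have := Fintype.ofFinite ι
  choose H hH using hP
  refine ⟨Finset.univ.biUnion H, ?_⟩
  ext x
  simp only [hH, mem_iInter, mem_ofPred_eq, Finset.mem_biUnion, Finset.mem_univ, true_and]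
  exact ⟨fun h f ⟨i, hf⟩ => h i f hf, fun h i f hf => h f ⟨i, hf⟩⟩

theorem IsPolyhedron.inter {P Q : Set E} (hP : IsPolyhedron P) (hQ : IsPolyhedron Q) :
    IsPolyhedron (P ∩ Q) := by
  rw [inter_eq_iInter]
  exact .iInter (Bool.forall_bool.2 ⟨hQ, hP⟩)

theorem isPolyhedron_le (f g : E →L[ℝ] ℝ) : IsPolyhedron {x | f x ≤ g x} := by
  refine ⟨{(f - g, 0)}, ?_⟩
  ext x
  simp

theorem isPolyhedron_eq (f g : E →L[ℝ] ℝ) : IsPolyhedron {x | f x = g x} := by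
  have h : {x | f x = g x} = {x | f x ≤ g x} ∩ {x | g x ≤ f x} := ext fun x => le_antisymm_iff
  rw [h]
  exact (isPolyhedron_le f g).inter (isPolyhedron_le g f)

theorem isPiecewiseLinear_of_le {X : Set E} (hX : IsPolyhedron X) {f : X → F} (hf : Continuous f)
    (g h : E →L[ℝ] ℝ) (L M : E →ₗ[ℝ] F) (hL : ∀ x : X, g x ≤ h x → f x = L x)
    (hM : ∀ x : X, h x ≤ g x → f x = M x) : IsPiecewiseLinear f := by
  classical
  refine ⟨hf, {X ∩ {x | g x ≤ h x}, X ∩ {x | h x ≤ g x}}, ?_, ?_, ?_⟩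
  · simpa only [Finset.forall_mem_insert, Finset.mem_singleton, forall_eq] using
      ⟨hX.inter (isPolyhedron_le g h), hX.inter (isPolyhedron_le h g)⟩
  · rw [Finset.set_biUnion_insert, Finset.set_biUnion_singleton, ← inter_union_distrib_left]
    exact inter_eq_left.2 fun x _ => le_total (g x) (h x)
  · simpa only [Finset.forall_mem_insert, Finset.mem_singleton, forall_eq] using
      ⟨⟨L.toAffineMap, fun x hx => hL x hx.2⟩, ⟨M.toAffineMap, fun x hx => hM x hx.2⟩⟩

theorem TrainTrack.isPolyhedron_weightCone (τ : TrainTrack) : IsPolyhedron τ.weightCone := by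
  classical
  let sumOver (p : τ.Branch × Bool → Prop) : (τ.Branch → ℝ) →L[ℝ] ℝ :=
    ∑ e with p e, ContinuousLinearMap.proj e.1
  have h : τ.weightCone = (⋂ b, {w | (0 : (τ.Branch → ℝ) →L[ℝ] ℝ) w ≤
        ContinuousLinearMap.proj (R := ℝ) (φ := fun _ : τ.Branch => ℝ) b w}) ∩
      ⋂ e : {e // endPoint τ.curve e ∉ connectorBoundary},
        {w | sumOver (SameSide τ.curve e) w = sumOver (OppositeSide τ.curve e) w} := by
    ext w
    simp [TrainTrack.weightCone, sumOver]
  rw [h]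
  exact (IsPolyhedron.iInter fun _ => isPolyhedron_le _ _).inter
    (.iInter fun _ => isPolyhedron_eq _ _)

end Polyhedra

/-- The linear map that agrees with `planeCoord k` where the branch `b` has the smaller one of the
weights `t` and `y`. -/
def planeCoordLinear (k : Bool) (b : ConnectorBranch) : (ConnectorBranch → ℝ) →ₗ[ℝ] ℝ × ℝ :=
  let weightAt (b : ConnectorBranch) : (ConnectorBranch → ℝ) →ₗ[ℝ] ℝ := LinearMap.proj b
  (weightAt .short - weightAt .outer).prod (turn k • weightAt b)

theorem planeCoord_of_short_le {k : Bool} {W : ConnectorBranch → ℝ} (h : W .short ≤ W .outer) :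
    planeCoord k W = planeCoordLinear k .short W := by
  rw [planeCoord, min_eq_left h]
  rfl

theorem planeCoord_of_outer_le {k : Bool} {W : ConnectorBranch → ℝ} (h : W .outer ≤ W .short) :
    planeCoord k W = planeCoordLinear k .outer W := by
  rw [planeCoord, min_eq_right h]
  rfl

theorem isPiecewiseLinear_mlHomeomorph_mk (i : SubtrackIndex connectorTrack) :
    IsPiecewiseLinear fun w : (connectorCollection i).weightCone =>
      mlHomeomorph (MLSpace.mk connectorCollection i w) := by
  let weightAt (b : ConnectorBranch) : ((connectorCollection i).Branch → ℝ) →L[ℝ] ℝ :=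
    (LinearMap.proj b ∘ₗ ambientWeight connectorTrack i).toContinuousLinearMap
  have hcont : Continuous fun w : (connectorCollection i).weightCone =>
      mlHomeomorph (MLSpace.mk connectorCollection i w) :=
    mlHomeomorph.continuous.comp (continuous_quot_mk.comp continuous_sigmaMk)
  refine isPiecewiseLinear_of_le (connectorCollection i).isPolyhedron_weightCone hcont
    (weightAt .short) (weightAt .outer)
    (planeCoordLinear i.1 .short ∘ₗ ambientWeight connectorTrack i)
    (planeCoordLinear i.1 .outer ∘ₗ ambientWeight connectorTrack i)
    (fun w hw => ?_) fun w hw => ?_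
  · exact planeCoord_of_short_le (W := ambientWeight connectorTrack i w) hw
  · exact planeCoord_of_outer_le (W := ambientWeight connectorTrack i w) hw

section Quadrants

/-- The closed quadrant of the plane in which the coordinates have given signs, encoded in the same
way as the senses of turning. -/
def quadrant (k l : Bool) : Set (ℝ × ℝ) := {p | 0 ≤ turn k * p.1 ∧ 0 ≤ turn l * p.2}

open Classical in
/-- The subdivision of the plane into its closed quadrants. -/
def quadrants : Finset (Set (ℝ × ℝ)) := Finset.univ.image fun q : Bool × Bool => quadrant q.1 q.2

theorem isPolyhedron_quadrant (k l : Bool) : IsPolyhedron (quadrant k l) :=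
  (isPolyhedron_le 0 (turn k • ContinuousLinearMap.fst ℝ ℝ ℝ)).inter
    (isPolyhedron_le 0 (turn l • ContinuousLinearMap.snd ℝ ℝ ℝ))

theorem forall_mem_quadrants {r : Set (ℝ × ℝ) → Prop} :
    (∀ P ∈ quadrants, r P) ↔ ∀ k l, r (quadrant k l) := by
  simp only [quadrants, Finset.forall_mem_image, Finset.mem_univ, true_imp_iff, Prod.forall]

theorem biUnion_quadrants : ⋃ P ∈ quadrants, P = univ := by
  classical
  refine eq_univ_of_forall fun p => ?_
  obtain ⟨k, hk⟩ := exists_turn_mul_nonneg p.1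
  obtain ⟨l, hl⟩ := exists_turn_mul_nonneg p.2
  exact mem_biUnion (Finset.mem_image_of_mem _ (Finset.mem_univ (k, l))) ⟨hk, hl⟩

/-- The linear function that agrees with `shortWeight` on a quadrant. -/
def quadrantShort (k l : Bool) : ℝ × ℝ →ₗ[ℝ] ℝ :=
  turn l • LinearMap.snd ℝ ℝ ℝ + ((1 + turn k) / 2) • LinearMap.fst ℝ ℝ ℝ

/-- The linear function that agrees with `crossWeight` on a quadrant. -/
def quadrantCross (k l : Bool) : ℝ × ℝ →ₗ[ℝ] ℝ :=
  quadrantShort k l - LinearMap.fst ℝ ℝ ℝ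

/-- The linear map that agrees with `planeWeight` on a quadrant. -/
def quadrantWeight (k l : Bool) : ℝ × ℝ →ₗ[ℝ] (ConnectorBranch → ℝ) :=
  LinearMap.pi fun
    | .outer => quadrantCross k l
    | .inner => quadrantCross k l
    | .long => quadrantShort k l + quadrantCross k l
    | .short => quadrantShort k l

variable {k l : Bool} {p : ℝ × ℝ}

theorem turn_mul_eq_abs {x : ℝ} (h : 0 ≤ turn k * x) : turn k * x = |x| := by
  rw [← abs_turn_mul k, abs_of_nonneg h]

theorem quadrantShort_apply (hp : p ∈ quadrant k l) : quadrantShort k l p = shortWeight p := by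
  have hadd := max_zero_add_max_neg_zero_eq_abs_self p.1
  have hsub := max_zero_sub_max_neg_zero_eq_self p.1
  rw [← turn_mul_eq_abs hp.1] at hadd
  rw [shortWeight, ← turn_mul_eq_abs hp.2]
  simp only [quadrantShort, LinearMap.add_apply, LinearMap.smul_apply, LinearMap.fst_apply,
    LinearMap.snd_apply, smul_eq_mul]
  linarith

theorem quadrantCross_apply (hp : p ∈ quadrant k l) : quadrantCross k l p = crossWeight p := by
  rw [quadrantCross, LinearMap.sub_apply, quadrantShort_apply hp, LinearMap.fst_apply, shortWeight,
    crossWeight]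
  linarith [max_zero_sub_max_neg_zero_eq_self p.1]

theorem quadrantWeight_apply (hp : p ∈ quadrant k l) : quadrantWeight k l p = planeWeight p := by
  rw [planeWeight, ← quadrantShort_apply hp, ← quadrantCross_apply hp]
  funext b
  cases b <;> rfl

theorem mlHomeomorph_symm_apply (hp : 0 ≤ turn l * p.2) :
    ∃ h : wholeWeight (isFull_connectorTrack l) (planeWeight p) ∈
        (connectorCollection (wholeIndex (isFull_connectorTrack l))).weightCone,
      mlHomeomorph.symm p = MLSpace.mk _ _ ⟨_, h⟩ := by
  refine ⟨?_, mlHomeomorph.symm_apply_eq.2 ?_⟩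
  · exact wholeWeight_planeWeight_mem (C := fun i => (connectorCollection i).weightCone)
      (T := univ) (fun _ _ => (and_iff_left trivial).symm) l trivial
  · exact (planeCoord_planeWeight_of_nonneg hp).symm.trans (congrArg (planeCoord l)
      (ambientWeight_wholeWeight (isFull_connectorTrack l) (planeWeight p)).symm)

theorem isPLHomeomorph_mlHomeomorph : IsPLHomeomorph mlHomeomorph := by
  refine ⟨isPiecewiseLinear_mlHomeomorph_mk, quadrants,
    forall_mem_quadrants.2 isPolyhedron_quadrant, biUnion_quadrants,
    forall_mem_quadrants.2 fun k l => ?_⟩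
  refine ⟨wholeIndex (isFull_connectorTrack l), (LinearMap.funLeft ℝ ℝ
    (fun b : (Finset.univ : Finset ConnectorBranch) => b.1) ∘ₗ
      quadrantWeight k l).toAffineMap, fun p hp => ?_⟩
  have h := mlHomeomorph_symm_apply hp.2
  rw [← quadrantWeight_apply hp] at h
  exact h

theorem isPiecewiseLinear_crossWeight :
    IsPiecewiseLinear fun p : (univ : Set (ℝ × ℝ)) => crossWeight p :=
  ⟨continuous_crossWeight.comp continuous_subtype_val, quadrants,
    forall_mem_quadrants.2 isPolyhedron_quadrant, biUnion_quadrants, forall_mem_quadrants.2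
      fun k l => ⟨(quadrantCross k l).toAffineMap, fun _ hp => (quadrantCross_apply hp).symm⟩⟩

end Quadrants

/-- The weight that a measured lamination induces on either boundary circle. -/
def mlBoundaryWeight (x : MLSpace connectorCollection) : ℝ := crossWeight (mlHomeomorph x)

theorem mlBoundaryWeight_symm (p : ℝ × ℝ) :
    mlBoundaryWeight (mlHomeomorph.symm p) = crossWeight p :=
  congrArg crossWeight (mlHomeomorph.apply_symm_apply p)

theorem mlBoundaryWeight_mk (i : SubtrackIndex connectorTrack)
    (w : (connectorCollection i).weightCone) :
    mlBoundaryWeight (MLSpace.mk connectorCollection i w) =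
        (connectorCollection i).boundaryWeight outerBoundary w ∧
      mlBoundaryWeight (MLSpace.mk connectorCollection i w) =
        (connectorCollection i).boundaryWeight innerBoundary w := by
  have hw := (ambientWeight_mem_weightCone_iff i w.1).2 w.2
  obtain ⟨⟨hs, ho⟩, hW⟩ := mem_weightCone_connectorTrack_iff.1 hw
  have hcross : mlBoundaryWeight (MLSpace.mk connectorCollection i w) =
      ambientWeight connectorTrack i w ConnectorBranch.outer := crossWeight_planeCoord i.1 hs ho
  have hinner : ambientWeight connectorTrack i w ConnectorBranch.inner =
      ambientWeight connectorTrack i w ConnectorBranch.outer := congrFun hW .inner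
  exact ⟨hcross.trans ((boundaryWeight_outerBoundary i.1 _).symm.trans
      (boundaryWeight_ambientWeight i _ _)),
    hcross.trans (hinner.symm.trans ((boundaryWeight_innerBoundary i.1 _).symm.trans
      (boundaryWeight_ambientWeight i _ _)))⟩

end Lam

theorem mainTheorem8 :
    (∀ k : Bool, BijOn (fun p : ℝ × ℝ => Lam.connectorWeight p.1 p.2)
      {p : ℝ × ℝ | 0 ≤ p.1 ∧ 0 ≤ p.2} (Lam.connectorTrack k).weightCone) ∧
    Lam.IsClosedCollection Lam.connectorCollection ∧
    Nonempty (Lam.PMLSpace Lam.connectorCollection ≃ₜ Circle) ∧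
    ∃ Φ : Lam.MLSpace Lam.connectorCollection ≃ₜ ℝ × ℝ,
      Lam.IsPLHomeomorph Φ ∧
      ∃ y : Lam.MLSpace Lam.connectorCollection → ℝ,
        (∀ i (w : (Lam.connectorCollection i).weightCone),
          y (Lam.MLSpace.mk Lam.connectorCollection i w) =
              (Lam.connectorCollection i).boundaryWeight Lam.outerBoundary w ∧
          y (Lam.MLSpace.mk Lam.connectorCollection i w) =
              (Lam.connectorCollection i).boundaryWeight Lam.innerBoundary w) ∧
        Lam.IsPiecewiseLinear (fun p : (univ : Set (ℝ × ℝ)) => y (Φ.symm p)) := by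
  refine ⟨Lam.bijOn_connectorWeight, Lam.isClosedCollection_fullSubtracks,
    ⟨Lam.pmlHomeomorph⟩, Lam.mlHomeomorph, Lam.isPLHomeomorph_mlHomeomorph, Lam.mlBoundaryWeight,
    Lam.mlBoundaryWeight_mk, ?_⟩
  simp only [Lam.mlBoundaryWeight_symm]
  exact Lam.isPiecewiseLinear_crossWeight
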